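/- Let $1\le m\le n$. Let $\mathbb S(2n)$ be the space of real symmetric $2n\times 2n$ matrices, $\mathbb P(2n)$ its subset of positive definite matrices, and $J=\begin{pmatrix}0&I_n\\-I_n&0\end{pmatrix}$. A real $2n\times 2n$ matrix $M$ is symplectic if $M^TJM=J$. By Williamson's theorem, for $A\in\mathbb P(2n)$ there is a symplectic $M$ with $M^TAM=\begin{pmatrix}D&0\\0&D\end{pmatrix}$, where $D$ is diagonal with positive diagonal entries $d_1(A)\le\dots\le d_n(A)$; these numbers are determined by $A$ and are called the symplectic eigenvalues of $A$. Define $\sigma_m:\mathbb S(2n)\to(-\infty,\infty]$ by $\sigma_m(P)=-2\sum_{j=1}^m d_j(P)$ for $P\in\mathbb P(2n)$ and $\sigma_m(P)=\infty$ otherwise. Let $A\in\mathbb P(2n)$. Let $i_m\ge 1$ be the number of indices $k\le m$ with $d_k(A)=d_m(A)$, let $j_m\ge 0$ be the number of indices $k$ with $m<k\le n$ and $d_k(A)=d_m(A)$, and let $r_m=i_m+j_m$ be the multiplicity of $d_m(A)$. Let $M=[u_1,\dots,u_n,v_1,\dots,v_n]$ be a real $2n\times 2n$ matrix whose columns satisfy,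 for all $1\le j,k\le n$, $$\langle u_j,Ju_k\rangle=\langle v_j,Jv_k\rangle=0,\qquad \langle u_j,Jv_k\rangle=\delta_{jk},\qquad Au_j=d_j(A)Jv_j,\qquad Av_j=-d_j(A)Ju_j.$$ Let $\overline M$ be the matrix with columns $u_k$ ($1\le k\le m-i_m$) followed by $v_k$ ($1\le k\le m-i_m$), and let $\widetilde M$ be the $2n\times 2r_m$ matrix with columns $u_k$ ($m-i_m<k\le m+j_m$) followed by $v_k$ ($m-i_m<k\le m+j_m$). For $B\in\mathbb S(2n)$ put $\overline B=-\overline M^TB\overline M$ and $$\widetilde B=-\widetilde M^TB\widetilde M=\begin{pmatrix}\tilde B_{11}&\tilde B_{12}\\ \tilde B_{12}^T&\tilde B_{22}\end{pmatrix}$$ with $r_m\times r_m$ blocks, and let $\widetilde{\widetilde B}$ be the Hermitian $r_m\times r_m$ matrix $\tilde B_{11}+\tilde B_{22}+\iota(\tilde B_{12}-\tilde B_{12}^T)$, where $\iota=\sqrt{-1}$. Then, for every $B\in\mathbb S(2n)$, the directional derivative $\sigma_m'(A;B)=\lim_{t\to0^+}\frac{\sigma_m(A+tB)-\sigma_m(A)}{t}$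 exists in $\mathbb R$ and $$\sigma_m'(A;B)=\operatorname{tr}\overline B+\sum_{j=1}^{i_m}\lambda_j^{\downarrow}(\widetilde{\widetilde B}),$$ where $\lambda_j^{\downarrow}(\widetilde{\widetilde B})$ denotes the $j$-th largest eigenvalue of $\widetilde{\widetilde B}$, counted with multiplicity (and $\operatorname{tr}\overline B=0$ if $m=i_m$). -/

import Mathlib

open Matrix

/-- The real vector space `𝕊(2n)` of real symmetric `2n × 2n` matrices. The `2n` indices are
`Fin n ⊕ Fin n`, so that a `2n × 2n` matrix is a block matrix with four `n × n` blocks. -/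
def SymMat (n : ℕ) : Submodule ℝ (Matrix (Fin n ⊕ Fin n) (Fin n ⊕ Fin n) ℝ) where
  carrier := {A | A.IsSymm}
  add_mem' ha hb := Matrix.IsSymm.add ha hb
  zero_mem' := Matrix.isSymm_zero
  smul_mem' c _ ha := Matrix.IsSymm.smul ha c

/-- The matrix `J = [[0, I], [-I, 0]]`. -/
def sympJ (n : ℕ) : Matrix (Fin n ⊕ Fin n) (Fin n ⊕ Fin n) ℝ :=
  Matrix.fromBlocks 0 1 (-1) 0

/-- `d₁ ≤ ⋯ ≤ d_n` are the positive diagonal entries of a Williamson normal form of `A`: there is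
a symplectic matrix `M` with `Mᵀ A M = diag(D, D)`, where `D = diag(d₁, …, d_n)`. -/
def IsWilliamson {n : ℕ} (A : Matrix (Fin n ⊕ Fin n) (Fin n ⊕ Fin n) ℝ) (d : Fin n → ℝ) : Prop :=
  Monotone d ∧ (∀ j, 0 < d j) ∧
    ∃ M : Matrix (Fin n ⊕ Fin n) (Fin n ⊕ Fin n) ℝ,
      Mᵀ * sympJ n * M = sympJ n ∧
      Mᵀ * A * M = Matrix.fromBlocks (Matrix.diagonal d) 0 0 (Matrix.diagonal d)

open Classical in
/-- The symplectic eigenvalues of `A` in nondecreasing order. For a positive definite `A` they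
exist and are unique by Williamson's theorem; the value `0` is used for a matrix `A` that has no
Williamson normal form. -/
noncomputable def sympEigFin {n : ℕ} (A : Matrix (Fin n ⊕ Fin n) (Fin n ⊕ Fin n) ℝ) :
    Fin n → ℝ :=
  if h : ∃ d, IsWilliamson A d then h.choose else 0

/-- `d_j(A)` for `1 ≤ j ≤ n` (numbered from `1`; the value is `0` for other `j`). -/
noncomputable def sympEig {n : ℕ} (A : Matrix (Fin n ⊕ Fin n) (Fin n ⊕ Fin n) ℝ) (j : ℕ) : ℝ :=
  if h : 1 ≤ j ∧ j ≤ n then sympEigFin A ⟨j - 1, by omega⟩ else 0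

open Classical in
/-- `σ_m : 𝕊(2n) → (-∞, ∞]`, equal to `-2 ∑_{j=1}^m d_j(P)` if `P` is positive definite and to `∞`
otherwise. -/
noncomputable def sigma (n m : ℕ) (P : SymMat n) : EReal :=
  if (P : Matrix (Fin n ⊕ Fin n) (Fin n ⊕ Fin n) ℝ).PosDef then
    ((-2 * ∑ j ∈ Finset.Icc 1 m, sympEig P.1 j : ℝ) : EReal)
  else ⊤

/-- `f'(A; H)` is defined and equal to the real number `L`: the one-sided limit
`lim_{t → 0⁺} (f(A + tH) - f(A)) / t` exists and is `L`. -/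
def HasDirDeriv {E : Type*} [AddCommGroup E] [Module ℝ E] (f : E → EReal) (A H : E) (L : ℝ) :
    Prop :=
  Filter.Tendsto (fun t : ℝ => (f (A + t • H) - f A) / (t : EReal))
    (nhdsWithin (0 : ℝ) (Set.Ioi 0)) (nhds (L : EReal))

/-- `Sp(2n, 2n, A)`: the matrices `M = [u₁, …, u_n, v₁, …, v_n]` whose columns form a symplectic
basis of `ℝ²ⁿ` consisting of symplectic eigenvector pairs: `A u_j = d_j(A) J v_j` and
`A v_j = -d_j(A) J u_j`. Here `M.col (Sum.inl j)` is `u_j` and `M.col (Sum.inr j)` is `v_j`. -/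
def SpEig (n : ℕ) (A : Matrix (Fin n ⊕ Fin n) (Fin n ⊕ Fin n) ℝ) :
    Set (Matrix (Fin n ⊕ Fin n) (Fin n ⊕ Fin n) ℝ) :=
  {M | (∀ j k : Fin n,
        M.col (Sum.inl j) ⬝ᵥ (sympJ n *ᵥ M.col (Sum.inl k)) = 0 ∧
        M.col (Sum.inr j) ⬝ᵥ (sympJ n *ᵥ M.col (Sum.inr k)) = 0 ∧
        M.col (Sum.inl j) ⬝ᵥ (sympJ n *ᵥ M.col (Sum.inr k)) = if j = k then 1 else 0) ∧
      ∀ j : Fin n,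
        A *ᵥ M.col (Sum.inl j) = sympEig A (j + 1) • (sympJ n *ᵥ M.col (Sum.inr j)) ∧
        A *ᵥ M.col (Sum.inr j) = -(sympEig A (j + 1)) • (sympJ n *ᵥ M.col (Sum.inl j))}

/-- `i_m`: the number of indices `k ≤ m` with `d_k(A) = d_m(A)`. -/
noncomputable def iIdx {n : ℕ} (A : Matrix (Fin n ⊕ Fin n) (Fin n ⊕ Fin n) ℝ) (m : ℕ) : ℕ :=
  Finset.card {k ∈ Finset.Icc 1 m | sympEig A k = sympEig A m}

/-- `j_m`: the number of indices `m < k ≤ n` with `d_k(A) = d_m(A)`. -/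
noncomputable def jIdx {n : ℕ} (A : Matrix (Fin n ⊕ Fin n) (Fin n ⊕ Fin n) ℝ) (m : ℕ) : ℕ :=
  Finset.card {k ∈ Finset.Icc (m + 1) n | sympEig A k = sympEig A m}

/-- `r_m = i_m + j_m`: the multiplicity of the symplectic eigenvalue `d_m(A)`. -/
noncomputable def rIdx {n : ℕ} (A : Matrix (Fin n ⊕ Fin n) (Fin n ⊕ Fin n) ℝ) (m : ℕ) : ℕ :=
  iIdx A m + jIdx A m

theorem iIdx_le {n : ℕ} (A : Matrix (Fin n ⊕ Fin n) (Fin n ⊕ Fin n) ℝ) (m : ℕ) :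
    iIdx A m ≤ m := by
  unfold iIdx
  exact (Finset.card_filter_le _ _).trans (by simp)

theorem add_jIdx_le {n : ℕ} (A : Matrix (Fin n ⊕ Fin n) (Fin n ⊕ Fin n) ℝ) {m : ℕ} (hmn : m ≤ n) :
    m + jIdx A m ≤ n := by
  have h : jIdx A m ≤ (Finset.Icc (m + 1) n).card := Finset.card_filter_le _ _
  rw [Nat.card_Icc] at h
  omega

theorem bar_bound {n : ℕ} (A : Matrix (Fin n ⊕ Fin n) (Fin n ⊕ Fin n) ℝ) {m : ℕ} (hmn : m ≤ n) :
    0 + (m - iIdx A m) ≤ n := by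
  omega

theorem tilde_bound {n : ℕ} (A : Matrix (Fin n ⊕ Fin n) (Fin n ⊕ Fin n) ℝ) {m : ℕ} (hmn : m ≤ n) :
    (m - iIdx A m) + rIdx A m ≤ n := by
  have h₁ := iIdx_le A m
  have h₂ := add_jIdx_le A hmn
  unfold rIdx
  omega

theorem iIdx_le_card {n : ℕ} (A : Matrix (Fin n ⊕ Fin n) (Fin n ⊕ Fin n) ℝ) (m : ℕ) :
    iIdx A m ≤ Fintype.card (Fin (rIdx A m)) := by
  rw [Fintype.card_fin]
  exact Nat.le_add_right _ _

/-- A block of a symplectic column partition of `S`: the columns of `S` with (one-based) indices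
`a + 1, …, a + α, n + a + 1, …, n + a + α`, in this order. -/
def sympCols {ι : Type*} {n : ℕ} (S : Matrix ι (Fin n ⊕ Fin n) ℝ) (a α : ℕ) (h : a + α ≤ n) :
    Matrix ι (Fin α ⊕ Fin α) ℝ :=
  let e : Fin α → Fin n := fun k => ⟨a + k, by omega⟩
  S.submatrix id (Sum.map e e)

/-- `M̄ = M Ī`, where `Ī` is the first block of the symplectic column partition of `I` of order
`(m - i_m, r_m, n - m - j_m)`. -/
noncomputable def Mbar {n : ℕ} (A M : Matrix (Fin n ⊕ Fin n) (Fin n ⊕ Fin n) ℝ) {m : ℕ}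
    (hmn : m ≤ n) :
    Matrix (Fin n ⊕ Fin n) (Fin (m - iIdx A m) ⊕ Fin (m - iIdx A m)) ℝ :=
  M * sympCols (1 : Matrix (Fin n ⊕ Fin n) (Fin n ⊕ Fin n) ℝ) 0 (m - iIdx A m) (bar_bound A hmn)

/-- `M̃ = M Ĩ`, where `Ĩ` is the second block of the same symplectic column partition of `I`. -/
noncomputable def Mtilde {n : ℕ} (A M : Matrix (Fin n ⊕ Fin n) (Fin n ⊕ Fin n) ℝ) {m : ℕ}
    (hmn : m ≤ n) :
    Matrix (Fin n ⊕ Fin n) (Fin (rIdx A m) ⊕ Fin (rIdx A m)) ℝ :=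
  M * sympCols (1 : Matrix (Fin n ⊕ Fin n) (Fin n ⊕ Fin n) ℝ) (m - iIdx A m) (rIdx A m)
    (tilde_bound A hmn)

/-- `B̄ = -M̄ᵀ B M̄`. -/
noncomputable def Bbar {n : ℕ} (A M B : Matrix (Fin n ⊕ Fin n) (Fin n ⊕ Fin n) ℝ) {m : ℕ}
    (hmn : m ≤ n) :
    Matrix (Fin (m - iIdx A m) ⊕ Fin (m - iIdx A m)) (Fin (m - iIdx A m) ⊕ Fin (m - iIdx A m)) ℝ :=
  -((Mbar A M hmn)ᵀ * B * Mbar A M hmn)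

/-- `B̃ = -M̃ᵀ B M̃`. -/
noncomputable def Btilde {n : ℕ} (A M B : Matrix (Fin n ⊕ Fin n) (Fin n ⊕ Fin n) ℝ) {m : ℕ}
    (hmn : m ≤ n) :
    Matrix (Fin (rIdx A m) ⊕ Fin (rIdx A m)) (Fin (rIdx A m) ⊕ Fin (rIdx A m)) ℝ :=
  -((Mtilde A M hmn)ᵀ * B * Mtilde A M hmn)

/-- For a real block matrix `C = [[C₁₁, C₁₂], [C₁₂ᵀ, C₂₂]]` with `r × r` blocks, the complex matrix
`C₁₁ + C₂₂ + i (C₁₂ - C₁₂ᵀ)`. -/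
noncomputable def hermPart {r : ℕ} (C : Matrix (Fin r ⊕ Fin r) (Fin r ⊕ Fin r) ℝ) :
    Matrix (Fin r) (Fin r) ℂ :=
  (C.toBlocks₁₁ + C.toBlocks₂₂).map (fun x : ℝ => (x : ℂ)) +
    Complex.I • (C.toBlocks₁₂ - C.toBlocks₁₂ᵀ).map (fun x : ℝ => (x : ℂ))

/-- The matrix `B̃̃ = B̃₁₁ + B̃₂₂ + i (B̃₁₂ - B̃₁₂ᵀ)`. -/
noncomputable def Btt {n : ℕ} (A M B : Matrix (Fin n ⊕ Fin n) (Fin n ⊕ Fin n) ℝ) {m : ℕ}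
    (hmn : m ≤ n) : Matrix (Fin (rIdx A m)) (Fin (rIdx A m)) ℂ :=
  hermPart (Btilde A M B hmn)

theorem hermPart_isHermitian {r : ℕ} {C : Matrix (Fin r ⊕ Fin r) (Fin r ⊕ Fin r) ℝ}
    (hC : C.IsSymm) : (hermPart C).IsHermitian := by
  ext a b
  have h₁ := hC.apply (Sum.inl a) (Sum.inl b)
  have h₂ := hC.apply (Sum.inr a) (Sum.inr b)
  simp [hermPart, Matrix.toBlocks₁₁, Matrix.toBlocks₂₂, Matrix.toBlocks₁₂, h₁, h₂]
  ring

theorem Btt_isHermitian {n : ℕ} (A M : Matrix (Fin n ⊕ Fin n) (Fin n ⊕ Fin n) ℝ)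
    (B : SymMat n) {m : ℕ} (hmn : m ≤ n) : (Btt A M B.1 hmn).IsHermitian := by
  apply hermPart_isHermitian
  have hB : (B.1)ᵀ = B.1 := B.2
  unfold Btilde
  simp only [Matrix.IsSymm, Matrix.transpose_neg, Matrix.transpose_mul, Matrix.transpose_transpose,
    hB, Matrix.mul_assoc]

/-! For positive definite P, the number 2(d_1(P) + ... + d_m(P)) is the minimum of Re tr(Xᴴ P X)
over complex 2n × m matrices X with Xᴴ(-iJ)X = 2. So σ_m is a maximum of linear functionals, and its
derivative at A along B should be the maximum of -Re tr(Xᴴ B X) over the minimizers X at A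
(Danskin's principle). A minimizer at A, tested at A + tB, bounds the difference quotient from
below. For the upper bound, minimizers at A + t_k B stay bounded because positive definiteness is
uniform for small t, and a limit of them is a minimizer at A (`tendsto_quotient`).

The minimum is computed in a Williamson basis. With respect to the vectors u_j ± iv_j the constraint
reads CᴴC - EᴴE = 1, and the trace is 2 ∑ d_j(|C_j|² + |E_j|²), where C_j, E_j are rows. The
orthogonal projection onto the range of C has trace m and diagonal entries p_j ≤ |C_j|²
(`exists_projection_diag`), so the trace is at least 2 ∑ d_j p_j. Weights in [0, 1] of total mass m
do best on the m smallest d_j.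

Equality forces E = 0, and CCᴴ is then a projection of rank m that is the identity where d_j < d_m
and zero where d_j > d_m; it remains free, of rank i_m, on the block d_j = d_m. On such X the form
of B is that of the Hermitian matrix `hermPart (Mᵀ * B * M)`. The fixed part contributes tr B̄, and
Ky Fan's principle on the free block contributes the i_m largest eigenvalues of B̃̃. Only existence
in Williamson's theorem is used. -/

/-! ### Weighted sums of a monotone sequence -/

/-- Replacing the first `m` of the values `d` by a weighted sum with weights in `[0, 1]` of total
mass `m` costs a sum of nonnegative terms. -/
theorem sum_mul_eq_sum_castLE_add {n m : ℕ} (hmn : m ≤ n) (d p : Fin n → ℝ)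
    (hs : ∑ j, p j = m) (θ : ℝ) :
    ∑ j, d j * p j = ∑ j : Fin m, d (Fin.castLE hmn j) +
      ∑ j, (d j - θ) * (p j - if (j : ℕ) < m then 1 else 0) := by
  have key : ∀ f : Fin n → ℝ, ∑ j : Fin m, f (Fin.castLE hmn j) =
      ∑ j, f j * (if (j : ℕ) < m then 1 else 0) := by
    intro f
    simp only [mul_ite, mul_one, mul_zero]
    rw [← Finset.sum_filter]
    refine Finset.sum_bij (fun j _ => Fin.castLE hmn j) ?_ ?_ ?_ ?_
    · intro j _; simp
    · intro a _ b _ h; exact Fin.castLE_injective hmn h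
    · intro b hb
      exact ⟨⟨b, by simpa using hb⟩, Finset.mem_univ _, rfl⟩
    · intro j _; rfl
  have h1 := key fun _ => 1
  simp only [Finset.sum_const, Finset.card_univ, Fintype.card_fin, nsmul_eq_mul, mul_one,
    one_mul] at h1
  rw [key d]
  have : ∀ j, (d j - θ) * (p j - if (j : ℕ) < m then 1 else 0) = d j * p j -
      d j * (if (j : ℕ) < m then 1 else 0) - θ * p j + θ * (if (j : ℕ) < m then 1 else 0) := by
    intro j; ring
  simp only [this, Finset.sum_add_distrib, Finset.sum_sub_distrib, ← Finset.mul_sum, hs, ← h1]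
  ring

/-- With the threshold θ = d_m (zero-based index `m - 1`) both factors change sign at the same
place. -/
theorem excess_nonneg {n m : ℕ} (hm : 1 ≤ m) (hmn : m ≤ n) {d p : Fin n → ℝ} (hd : Monotone d)
    (h0 : ∀ j, 0 ≤ p j) (h1 : ∀ j, p j ≤ 1) (j : Fin n) :
    0 ≤ (d j - d ⟨m - 1, by omega⟩) * (p j - if (j : ℕ) < m then 1 else 0) := by
  split_ifs with h
  · refine mul_nonneg_of_nonpos_of_nonpos ?_ (by linarith [h1 j])
    have : d j ≤ d ⟨m - 1, by omega⟩ := hd (by rw [Fin.le_def]; show (j : ℕ) ≤ m - 1; omega)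
    linarith
  · refine mul_nonneg ?_ (by linarith [h0 j])
    have : d ⟨m - 1, by omega⟩ ≤ d j := hd (by rw [Fin.le_def]; show m - 1 ≤ (j : ℕ); omega)
    linarith

theorem sum_castLE_le_sum_mul {n m : ℕ} (hmn : m ≤ n) {d p : Fin n → ℝ} (hd : Monotone d)
    (h0 : ∀ j, 0 ≤ p j) (h1 : ∀ j, p j ≤ 1) (hs : ∑ j, p j = m) :
    ∑ j : Fin m, d (Fin.castLE hmn j) ≤ ∑ j, d j * p j := by
  -- For `m = 0` there may be no index to serve as threshold, but all weights vanish.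
  rcases Nat.eq_zero_or_pos m with rfl | hm
  · have : ∀ j, p j = 0 := by
      intro j
      refine (Finset.sum_eq_zero_iff_of_nonneg fun j _ => h0 j).1 (by simpa using hs) j
        (Finset.mem_univ j)
    simp [this]
  · rw [sum_mul_eq_sum_castLE_add hmn d p hs (d ⟨m - 1, by omega⟩)]
    exact le_add_of_nonneg_right (Finset.sum_nonneg fun j _ => excess_nonneg hm hmn hd h0 h1 j)

/-- Equality makes a sum of nonnegative excess terms zero, so each vanishes; where d_j differs from
the threshold, the weight factor must be the zero one. -/
theorem weight_of_sum_mul_eq {n m : ℕ} (hm : 1 ≤ m) (hmn : m ≤ n) {d p : Fin n → ℝ}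
    (hd : Monotone d) (h0 : ∀ j, 0 ≤ p j) (h1 : ∀ j, p j ≤ 1) (hs : ∑ j, p j = m)
    (h : ∑ j, d j * p j = ∑ j : Fin m, d (Fin.castLE hmn j)) (j : Fin n) :
    (d j < d ⟨m - 1, by omega⟩ → p j = 1) ∧ (d ⟨m - 1, by omega⟩ < d j → p j = 0) := by
  rw [sum_mul_eq_sum_castLE_add hmn d p hs (d ⟨m - 1, by omega⟩), add_eq_left,
    Finset.sum_eq_zero_iff_of_nonneg fun j _ => excess_nonneg hm hmn hd h0 h1 j] at h
  have hj := mul_eq_zero.1 (h j (Finset.mem_univ j))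
  constructor
  · intro hlt
    have hjm : (j : ℕ) < m := by
      by_contra hc
      exact absurd (hd (show (⟨m - 1, by omega⟩ : Fin n) ≤ j by
        rw [Fin.le_def]; show m - 1 ≤ (j : ℕ); omega)) (not_le.2 hlt)
    rcases hj with hj | hj
    · linarith
    · rw [if_pos hjm] at hj; linarith
  · intro hlt
    have hjm : ¬ (j : ℕ) < m := by
      intro hc
      exact absurd (hd (show j ≤ (⟨m - 1, by omega⟩ : Fin n) by
        rw [Fin.le_def]; show (j : ℕ) ≤ m - 1; omega)) (not_le.2 hlt)
    rcases hj with hj | hj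
    · linarith
    · rw [if_neg hjm] at hj; linarith

/-! ### Diagonals of orthogonal projections -/

section
open scoped ComplexOrder
variable {κ κ' ι : Type*}

theorem Matrix.PosSemidef.re_diag_nonneg {Q : Matrix κ κ ℂ} (hQ : Q.PosSemidef) (j : κ) :
    0 ≤ (Q j j).re :=
  (Complex.nonneg_iff.1 (hQ.diag_nonneg (i := j))).1

theorem Matrix.PosSemidef.re_diag_le_one [DecidableEq κ] {Q : Matrix κ κ ℂ} (hQ : (1 - Q).PosSemidef) (j : κ) :
    (Q j j).re ≤ 1 := by
  have := hQ.re_diag_nonneg j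
  simp at this
  linarith

/-- A Hermitian idempotent `Q` satisfies `0 ≤ Q ≤ 1`. -/
theorem Matrix.IsHermitian.posSemidef_of_idempotent [Fintype κ] [DecidableEq κ] {Q : Matrix κ κ ℂ} (h : Q.IsHermitian)
    (hQ : Q * Q = Q) : Q.PosSemidef ∧ (1 - Q).PosSemidef := by
  constructor
  · have := posSemidef_conjTranspose_mul_self Q
    rwa [h.eq, hQ] at this
  · have := posSemidef_conjTranspose_mul_self (1 - Q)
    rwa [conjTranspose_sub, h.eq, conjTranspose_one, sub_mul, one_mul, mul_sub, hQ, mul_one,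
      sub_self, sub_zero] at this

theorem mul_conjTranspose_self_apply_self [Fintype ι] (C : Matrix κ ι ℂ) (j : κ) :
    ((C * Cᴴ) j j).re = ∑ l, Complex.normSq (C j l) := by
  simp [Matrix.mul_apply, Complex.normSq_apply]

variable [Fintype κ] [Fintype κ'] [Fintype ι] [DecidableEq ι]

/-- If `Cᴴ C = 1 + Eᴴ E` then the orthogonal projection onto the range of `C` is dominated by
`C Cᴴ`; `p` lists its diagonal entries. -/
theorem exists_projection_diag {C : Matrix κ ι ℂ} {E : Matrix κ' ι ℂ}
    (h : Cᴴ * C - Eᴴ * E = 1) :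
    ∃ p : κ → ℝ, (∀ j, 0 ≤ p j) ∧ (∀ j, p j ≤ 1) ∧ ∑ j, p j = Fintype.card ι ∧
      ∀ j, p j ≤ ∑ l, Complex.normSq (C j l) := by
  set S := Cᴴ * C with hS
  have hS1 : S = 1 + Eᴴ * E := by rw [← h]; abel
  have hpd : S.PosDef := by
    rw [hS1]; exact PosDef.one.add_posSemidef (posSemidef_conjTranspose_mul_self E)
  have hu : IsUnit S.det := (Matrix.isUnit_iff_isUnit_det S).1 hpd.isUnit
  have hSi : S * S⁻¹ = 1 := Matrix.mul_nonsing_inv _ hu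
  have hiS : S⁻¹ * S = 1 := Matrix.nonsing_inv_mul _ hu
  have hih : (S⁻¹)ᴴ = S⁻¹ := hpd.inv.1.eq
  -- The orthogonal projection onto the range of C.
  set Q := C * S⁻¹ * Cᴴ with hQ
  have hQh : Q.IsHermitian := by
    rw [Matrix.IsHermitian, hQ]
    simp only [conjTranspose_mul, hih, conjTranspose_conjTranspose, Matrix.mul_assoc]
  classical
  have hQQ : Q * Q = Q := by
    calc Q * Q = C * S⁻¹ * (Cᴴ * C) * S⁻¹ * Cᴴ := by simp only [hQ, Matrix.mul_assoc]
      _ = Q := by rw [← hS, Matrix.mul_assoc C, hiS, Matrix.mul_one]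
  obtain ⟨hp0, hp1⟩ := hQh.posSemidef_of_idempotent hQQ
  have htr : Q.trace = Fintype.card ι := by
    rw [hQ, Matrix.trace_mul_comm, ← Matrix.mul_assoc, ← hS, hSi, Matrix.trace_one]
  -- The difference is C(1 - S⁻¹)Cᴴ, and S = 1 + EᴴE ≥ 1. Explicitly, 1 - S⁻¹ = S⁻¹(F + F²)S⁻¹ with
  -- F = EᴴE.
  have hle : (C * Cᴴ - Q).PosSemidef := by
    have h2 : (1 - S⁻¹).PosSemidef := by
      have h3 : 1 - S⁻¹ = (S⁻¹)ᴴ * (Eᴴ * E + (Eᴴ * E)ᴴ * (Eᴴ * E)) * S⁻¹ := by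
        have h4 : Eᴴ * E + (Eᴴ * E)ᴴ * (Eᴴ * E) = S * (S - 1) := by
          rw [conjTranspose_mul, conjTranspose_conjTranspose, hS1, add_sub_cancel_left, add_mul,
            one_mul]
        rw [h4, hih, ← Matrix.mul_assoc, hiS, one_mul, sub_mul, hSi, one_mul]
      rw [h3]
      exact ((posSemidef_conjTranspose_mul_self E).add
        (posSemidef_conjTranspose_mul_self _)).conjTranspose_mul_mul_same _
    have := h2.mul_mul_conjTranspose_same C
    rwa [Matrix.mul_sub, Matrix.sub_mul, Matrix.mul_one] at this
  refine ⟨fun j => (Q j j).re, hp0.re_diag_nonneg, PosSemidef.re_diag_le_one hp1, ?_, fun j => ?_⟩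
  · have := congrArg Complex.re htr
    simpa [Matrix.trace] using this
  · have := hle.re_diag_nonneg j
    rw [← mul_conjTranspose_self_apply_self]
    simpa using this

theorem sum_normSq_eq_card {C : Matrix κ ι ℂ} (h : Cᴴ * C = 1) :
    ∑ j, ∑ l, Complex.normSq (C j l) = Fintype.card ι := by
  have : ((C * Cᴴ).trace).re = Fintype.card ι := by
    rw [Matrix.trace_mul_comm, h, Matrix.trace_one]; simp
  rw [← this]
  simp only [Matrix.trace, Complex.re_sum, Matrix.diag]
  exact Finset.sum_congr rfl fun j _ => (mul_conjTranspose_self_apply_self C j).symm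

end

/-! ### The indefinite trace bound and Ky Fan's principle -/

section
open scoped ComplexOrder
variable {ι : Type*} [Fintype ι] [DecidableEq ι]

/-- The trace minimization bound for a diagonal matrix `diag(d, d)` over the columns that are
orthonormal for the indefinite form `diag(1, -1)`. -/
theorem sum_castLE_le_of_indefinite {n m : ℕ} (hmn : m ≤ n) {d : Fin n → ℝ} (hd : Monotone d)
    (hpos : ∀ j, 0 < d j) (hι : Fintype.card ι = m) {C E : Matrix (Fin n) ι ℂ}
    (h : Cᴴ * C - Eᴴ * E = 1) :
    ∑ j : Fin m, d (Fin.castLE hmn j) ≤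
      ∑ j, d j * (∑ l, Complex.normSq (C j l) + ∑ l, Complex.normSq (E j l)) := by
  obtain ⟨p, h0, h1, hs, hle⟩ := exists_projection_diag h
  refine (sum_castLE_le_sum_mul hmn hd h0 h1 (by rw [hs, hι])).trans ?_
  refine Finset.sum_le_sum fun j _ => mul_le_mul_of_nonneg_left ?_ (hpos j).le
  exact (hle j).trans
    (le_add_of_nonneg_right (Finset.sum_nonneg fun l _ => Complex.normSq_nonneg _))

/-- The chain ∑ d_j(|C_j|² + |E_j|²) ≥ ∑ d_j p_j ≥ d_1 + ... + d_m collapses. As d_j > 0, this gives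
|C_j|² + |E_j|² = p_j ≤ |C_j|², so E = 0 and the |C_j|² are themselves optimal weights. -/
theorem eq_zero_and_weights_of_indefinite_eq {n m : ℕ} (hm : 1 ≤ m) (hmn : m ≤ n) {d : Fin n → ℝ}
    (hd : Monotone d) (hpos : ∀ j, 0 < d j) (hι : Fintype.card ι = m) {C E : Matrix (Fin n) ι ℂ}
    (h : Cᴴ * C - Eᴴ * E = 1)
    (heq : ∑ j, d j * (∑ l, Complex.normSq (C j l) + ∑ l, Complex.normSq (E j l)) ≤
      ∑ j : Fin m, d (Fin.castLE hmn j)) :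
    E = 0 ∧ ∀ j, (d j < d ⟨m - 1, by omega⟩ → ∑ l, Complex.normSq (C j l) = 1) ∧
      (d ⟨m - 1, by omega⟩ < d j → ∑ l, Complex.normSq (C j l) = 0) := by
  obtain ⟨p, h0, h1, hs, hle⟩ := exists_projection_diag h
  have hE0 : ∀ j, 0 ≤ ∑ l, Complex.normSq (E j l) :=
    fun j => Finset.sum_nonneg fun l _ => Complex.normSq_nonneg _
  have hlow := sum_castLE_le_sum_mul hmn hd h0 h1 (by rw [hs, hι])
  have hsum : ∑ j, d j * (∑ l, Complex.normSq (C j l) + ∑ l, Complex.normSq (E j l) - p j) ≤ 0 := by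
    simp only [mul_sub, Finset.sum_sub_distrib]
    linarith
  have hterm : ∀ j, ∑ l, Complex.normSq (C j l) + ∑ l, Complex.normSq (E j l) - p j = 0 := by
    have hnn : ∀ j ∈ Finset.univ,
        0 ≤ d j * (∑ l, Complex.normSq (C j l) + ∑ l, Complex.normSq (E j l) - p j) :=
      fun j _ => mul_nonneg (hpos j).le (by linarith [hle j, hE0 j])
    intro j
    have := (Finset.sum_eq_zero_iff_of_nonneg hnn).1 (le_antisymm hsum (Finset.sum_nonneg hnn)) j
      (Finset.mem_univ j)
    exact (mul_eq_zero.1 this).resolve_left (hpos j).ne'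
  have hEz : ∀ j, ∑ l, Complex.normSq (E j l) = 0 :=
    fun j => le_antisymm (by linarith [hle j, hterm j]) (hE0 j)
  have hC : ∀ j, ∑ l, Complex.normSq (C j l) = p j := fun j => by linarith [hterm j, hEz j]
  refine ⟨?_, fun j => ?_⟩
  · ext j l
    exact Complex.normSq_eq_zero.1 ((Finset.sum_eq_zero_iff_of_nonneg
      fun l _ => Complex.normSq_nonneg _).1 (hEz j) l (Finset.mem_univ l))
  · rw [hC j]
    refine weight_of_sum_mul_eq hm hmn hd h0 h1 (by rw [hs, hι]) (le_antisymm ?_ hlow) j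
    refine le_trans (Finset.sum_le_sum fun j _ => mul_le_mul_of_nonneg_left ?_ (hpos j).le) heq
    linarith [hle j, hE0 j]

theorem Matrix.IsHermitian.eigenvectorUnitary_conj {H : Matrix ι ι ℂ} (hH : H.IsHermitian) :
    (hH.eigenvectorUnitary : Matrix ι ι ℂ)ᴴ * H * (hH.eigenvectorUnitary : Matrix ι ι ℂ) =
      diagonal fun i => (hH.eigenvalues i : ℂ) := by
  have := hH.conjStarAlgAut_star_eigenvectorUnitary
  rw [Unitary.conjStarAlgAut_star_apply] at this
  exact this

theorem Matrix.IsHermitian.eigenvectorUnitary_conjTranspose_mul {H : Matrix ι ι ℂ}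
    (hH : H.IsHermitian) :
    (hH.eigenvectorUnitary : Matrix ι ι ℂ)ᴴ * (hH.eigenvectorUnitary : Matrix ι ι ℂ) = 1 :=
  Unitary.coe_star_mul_self hH.eigenvectorUnitary

theorem Matrix.IsHermitian.eigenvectorUnitary_mul_conjTranspose {H : Matrix ι ι ℂ}
    (hH : H.IsHermitian) :
    (hH.eigenvectorUnitary : Matrix ι ι ℂ) * (hH.eigenvectorUnitary : Matrix ι ι ℂ)ᴴ = 1 :=
  Unitary.coe_mul_star_self hH.eigenvectorUnitary

/-- Ky Fan's maximum principle: the bound. -/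
theorem Matrix.IsHermitian.re_trace_mul_le_sum_eigenvalues₀ {H Q : Matrix ι ι ℂ}
    (hH : H.IsHermitian) (h0 : Q.PosSemidef) (h1 : (1 - Q).PosSemidef) {k : ℕ}
    (hk : k ≤ Fintype.card ι) (ht : Q.trace = k) :
    (H * Q).trace.re ≤ ∑ j : Fin k, hH.eigenvalues₀ (Fin.castLE hk j) := by
  set V := (hH.eigenvectorUnitary : Matrix ι ι ℂ) with hV
  have hVV : Vᴴ * V = 1 := hH.eigenvectorUnitary_conjTranspose_mul
  have hVV' : V * Vᴴ = 1 := hH.eigenvectorUnitary_mul_conjTranspose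
  set R := Vᴴ * Q * V with hR
  have hR0 : R.PosSemidef := h0.conjTranspose_mul_mul_same V
  have hR1 : (1 - R).PosSemidef := by
    have := h1.conjTranspose_mul_mul_same V
    rwa [Matrix.mul_sub, Matrix.sub_mul, Matrix.mul_one, hVV] at this
  have htr : R.trace = k := by
    rw [hR, Matrix.trace_mul_comm, ← Matrix.mul_assoc, hVV', one_mul, ht]
  have hHQ : (H * Q).trace = ∑ i, (hH.eigenvalues i : ℂ) * R i i := by
    have e1 : (H * Q).trace = ((Vᴴ * H * V) * R).trace := by
      have : Vᴴ * H * V * R = Vᴴ * (H * (V * Vᴴ) * Q * V) := by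
        simp only [hR, Matrix.mul_assoc]
      rw [this, hVV', Matrix.mul_one, Matrix.trace_mul_comm Vᴴ, Matrix.mul_assoc, hVV',
        Matrix.mul_one]
    rw [e1, hV, hH.eigenvectorUnitary_conj]
    simp [Matrix.trace, Matrix.diagonal_mul]
  -- This has to be the equivalence through which `eigenvalues` is defined from `eigenvalues₀`.
  set e : Fin (Fintype.card ι) ≃ ι := Fintype.equivOfCardEq (Fintype.card_fin _) with he
  have hev : ∀ i, hH.eigenvalues (e i) = hH.eigenvalues₀ i := by
    intro i
    simp [Matrix.IsHermitian.eigenvalues, he]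
  have hre : (H * Q).trace.re = ∑ i, hH.eigenvalues₀ i * (R (e i) (e i)).re := by
    rw [hHQ, Complex.re_sum, ← Equiv.sum_comp e]
    exact Finset.sum_congr rfl fun i _ => by rw [Complex.re_ofReal_mul, hev]
  -- The values `eigenvalues₀` decrease, so their negatives are the monotone sequence.
  have := sum_castLE_le_sum_mul hk (d := fun i => -hH.eigenvalues₀ i)
    (p := fun i => (R (e i) (e i)).re) (fun i j hij => neg_le_neg (hH.eigenvalues₀_antitone hij))
    (fun i => hR0.re_diag_nonneg _) (fun i => PosSemidef.re_diag_le_one hR1 _) ?_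
  · rw [hre]
    simp only [neg_mul, Finset.sum_neg_distrib] at this
    linarith
  · rw [Equiv.sum_comp e fun i => (R i i).re]
    have := congrArg Complex.re htr
    simpa [Matrix.trace] using this

/-- Ky Fan's maximum principle: the bound is attained. -/
theorem Matrix.IsHermitian.exists_orthonormal_trace_eq {H : Matrix ι ι ℂ}
    (hH : H.IsHermitian) {k : ℕ} (hk : k ≤ Fintype.card ι) :
    ∃ V : Matrix ι (Fin k) ℂ, Vᴴ * V = 1 ∧
      (Vᴴ * H * V).trace.re = ∑ j : Fin k, hH.eigenvalues₀ (Fin.castLE hk j) := by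
  set e : Fin (Fintype.card ι) ≃ ι := Fintype.equivOfCardEq (Fintype.card_fin _) with he
  have hev : ∀ i, hH.eigenvalues (e i) = hH.eigenvalues₀ i := by
    intro i
    simp [Matrix.IsHermitian.eigenvalues, he]
  let g : Fin k → ι := fun j => e (Fin.castLE hk j)
  have hg : Function.Injective g := e.injective.comp (Fin.castLE_injective hk)
  set W := (hH.eigenvectorUnitary : Matrix ι ι ℂ) with hW
  refine ⟨W.submatrix id g, ?_, ?_⟩
  · have : (W.submatrix id g)ᴴ * W.submatrix id g = (Wᴴ * W).submatrix g g := by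
      rw [conjTranspose_submatrix, Matrix.submatrix_mul _ _ g id g Function.bijective_id]
    rw [this, hW, hH.eigenvectorUnitary_conjTranspose_mul, Matrix.submatrix_one g hg]
  · have : (W.submatrix id g)ᴴ * H * W.submatrix id g = (Wᴴ * H * W).submatrix g g := by
      ext i j
      simp [Matrix.mul_apply]
    rw [this, hW, hH.eigenvectorUnitary_conj]
    simp [Matrix.trace, g, hev]

end

/-! ### Complex coordinates in a symplectic basis -/

/-- The entrywise inclusion of real into complex matrices. -/
def toComplex {κ ι : Type*} (M : Matrix κ ι ℝ) : Matrix κ ι ℂ := M.map fun x : ℝ => (x : ℂ)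

/-- The Hermitian matrix `-iJ`. -/
def hermJ (n : ℕ) : Matrix (Fin n ⊕ Fin n) (Fin n ⊕ Fin n) ℂ :=
  fromBlocks 0 (-(Complex.I • 1)) (Complex.I • 1) 0

/-- The matrix that sends the columns `[u, v]` to `[u + iv, u - iv]`. -/
def pairing (n : ℕ) : Matrix (Fin n ⊕ Fin n) (Fin n ⊕ Fin n) ℂ :=
  fromBlocks 1 1 (Complex.I • 1) (-(Complex.I • 1))

section
variable {κ ι μ : Type*}

theorem toComplex_mul [Fintype ι] (M : Matrix κ ι ℝ) (N : Matrix ι μ ℝ) :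
    toComplex (M * N) = toComplex M * toComplex N :=
  Matrix.map_mul (f := Complex.ofRealHom)

theorem conjTranspose_toComplex (M : Matrix κ ι ℝ) : (toComplex M)ᴴ = toComplex Mᵀ := by
  ext i j; simp [toComplex]

theorem toComplex_add (M N : Matrix κ ι ℝ) : toComplex (M + N) = toComplex M + toComplex N := by
  ext i j; simp [toComplex]

theorem toComplex_smul (c : ℝ) (M : Matrix κ ι ℝ) : toComplex (c • M) = (c : ℂ) • toComplex M := by
  ext i j; simp [toComplex]

theorem toComplex_one [DecidableEq ι] : toComplex (1 : Matrix ι ι ℝ) = 1 := by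
  ext i j; by_cases h : i = j <;> simp [toComplex, Matrix.one_apply, h]

end

theorem hermJ_eq (n : ℕ) : hermJ n = (-Complex.I) • toComplex (sympJ n) := by
  ext i j
  rcases i with i | i <;> rcases j with j | j <;> by_cases h : i = j <;>
    simp [hermJ, toComplex, sympJ, h]

/-- The two halves of the columns of `pairing` are eigenvectors of -iJ for the eigenvalues 1 and -1,
each of squared norm 2. -/
theorem pairing_hermJ (n : ℕ) :
    (pairing n)ᴴ * hermJ n * pairing n = (2 : ℂ) • fromBlocks 1 0 0 (-1) := by
  have h2 : (1 : Matrix (Fin n) (Fin n) ℂ) + 1 = (2 : ℂ) • 1 := by rw [two_smul]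
  simp [pairing, hermJ, fromBlocks_conjTranspose, fromBlocks_multiply, fromBlocks_smul, smul_smul]
  constructor
  · exact h2
  · rw [← h2]; abel

theorem hermJ_symplectic {n : ℕ} {M : Matrix (Fin n ⊕ Fin n) (Fin n ⊕ Fin n) ℝ}
    (hM : Mᵀ * sympJ n * M = sympJ n) :
    (toComplex M * pairing n)ᴴ * hermJ n * (toComplex M * pairing n) =
      (2 : ℂ) • fromBlocks 1 0 0 (-1) := by
  have h : (toComplex M)ᴴ * hermJ n * toComplex M = hermJ n := by
    rw [conjTranspose_toComplex, hermJ_eq, Matrix.mul_smul, Matrix.smul_mul, ← toComplex_mul,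
      ← toComplex_mul, hM]
  rw [← pairing_hermJ, conjTranspose_mul]
  conv_rhs => rw [← h]
  simp only [Matrix.mul_assoc]

section
variable {ι : Type*}

theorem signature_fromRows {n : ℕ} (C E : Matrix (Fin n) ι ℂ) :
    (fromRows C E)ᴴ * (fromBlocks 1 0 0 (-1) : Matrix (Fin n ⊕ Fin n) (Fin n ⊕ Fin n) ℂ) *
      fromRows C E = Cᴴ * C - Eᴴ * E := by
  rw [Matrix.mul_assoc, fromBlocks_mul_fromRows, conjTranspose_fromRows_eq_fromCols_conjTranspose,
    fromCols_mul_fromRows]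
  simp [sub_eq_add_neg]

theorem hermJ_of_coordinates {n : ℕ} [DecidableEq ι]
    {M : Matrix (Fin n ⊕ Fin n) (Fin n ⊕ Fin n) ℝ}
    (hM : Mᵀ * sympJ n * M = sympJ n) {C E : Matrix (Fin n) ι ℂ} (h : Cᴴ * C - Eᴴ * E = 1) :
    (toComplex M * pairing n * fromRows C E)ᴴ * hermJ n * (toComplex M * pairing n * fromRows C E) =
      (2 : ℂ) • 1 := by
  have := congrArg (fun Z => (fromRows C E)ᴴ * Z * fromRows C E) (hermJ_symplectic hM)
  simp only [Matrix.mul_smul, Matrix.smul_mul, signature_fromRows, h] at this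
  rw [← this]
  simp only [conjTranspose_mul, Matrix.mul_assoc]

/-- Coordinates of a normalized family `X` in a symplectic basis. -/
theorem exists_coordinates {n : ℕ} [DecidableEq ι] {M : Matrix (Fin n ⊕ Fin n) (Fin n ⊕ Fin n) ℝ}
    (hM : Mᵀ * sympJ n * M = sympJ n) {X : Matrix (Fin n ⊕ Fin n) ι ℂ}
    (hX : Xᴴ * hermJ n * X = (2 : ℂ) • 1) :
    ∃ C E : Matrix (Fin n) ι ℂ, X = toComplex M * pairing n * fromRows C E ∧
      Cᴴ * C - Eᴴ * E = 1 := by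
  set W := toComplex M * pairing n with hW
  set G : Matrix (Fin n ⊕ Fin n) (Fin n ⊕ Fin n) ℂ := fromBlocks 1 0 0 (-1) with hG
  have hGG : G * G = 1 := by simp [hG, fromBlocks_multiply]
  have hWK : Wᴴ * hermJ n * W = (2 : ℂ) • G := hermJ_symplectic hM
  -- The inverse of W is read off from WᴴKW = 2G with K = -iJ and G² = 1.
  have hinv : ((1 / 2 : ℂ) • (G * Wᴴ * hermJ n)) * W = 1 := by
    rw [Matrix.smul_mul, Matrix.mul_assoc G, Matrix.mul_assoc G, hWK, Matrix.mul_smul, hGG,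
      smul_smul]
    norm_num
  have hinv' := mul_eq_one_comm.1 hinv
  set Y := ((1 / 2 : ℂ) • (G * Wᴴ * hermJ n)) * X with hY
  have hXY : X = W * Y := by rw [hY, ← Matrix.mul_assoc, hinv', Matrix.one_mul]
  clear_value Y
  have hYr : fromRows Y.toRows₁ Y.toRows₂ = Y := fromRows_toRows Y
  refine ⟨Y.toRows₁, Y.toRows₂, by rw [hYr]; exact hXY, ?_⟩
  rw [← signature_fromRows, hYr]
  have h2 : (2 : ℂ) • (Yᴴ * G * Y) = (2 : ℂ) • 1 := by
    rw [← hX, hXY, conjTranspose_mul, ← Matrix.smul_mul, ← Matrix.mul_smul, ← hWK]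
    simp only [Matrix.mul_assoc]
  exact smul_right_injective _ (two_ne_zero' ℂ) h2

theorem pairing_mul_fromRows {n : ℕ} (C E : Matrix (Fin n) ι ℂ) :
    pairing n * fromRows C E = fromRows (C + E) (Complex.I • (C - E)) := by
  rw [pairing, fromBlocks_mul_fromRows]
  simp [sub_eq_add_neg]

/-- The quadratic form of `P` in symplectic coordinates in which it is diagonal. -/
theorem re_trace_of_diagonal {n : ℕ} [Fintype ι] {P M : Matrix (Fin n ⊕ Fin n) (Fin n ⊕ Fin n) ℝ}
    {d : Fin n → ℝ} (hP : Mᵀ * P * M = fromBlocks (diagonal d) 0 0 (diagonal d))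
    (C E : Matrix (Fin n) ι ℂ) :
    ((toComplex M * pairing n * fromRows C E)ᴴ * toComplex P *
      (toComplex M * pairing n * fromRows C E)).trace.re =
      2 * ∑ j, d j * (∑ l, Complex.normSq (C j l) + ∑ l, Complex.normSq (E j l)) := by
  have h1 : (toComplex M * pairing n * fromRows C E)ᴴ * toComplex P *
      (toComplex M * pairing n * fromRows C E) =
      (pairing n * fromRows C E)ᴴ * toComplex (Mᵀ * P * M) * (pairing n * fromRows C E) := by
    rw [Matrix.mul_assoc (toComplex M), conjTranspose_mul, toComplex_mul, toComplex_mul,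
      conjTranspose_toComplex]
    simp only [Matrix.mul_assoc]
  have h2 : toComplex (Mᵀ * P * M) = fromBlocks (diagonal fun j => (d j : ℂ)) 0 0
      (diagonal fun j => (d j : ℂ)) := by
    rw [hP]
    ext i j
    rcases i with i | i <;> rcases j with j | j <;> by_cases h : i = j <;>
      simp [toComplex, h]
  rw [h1, h2, pairing_mul_fromRows, Matrix.mul_assoc, fromBlocks_mul_fromRows,
    conjTranspose_fromRows_eq_fromCols_conjTranspose, fromCols_mul_fromRows, Matrix.trace_add,
    Matrix.trace_mul_comm, Matrix.trace_mul_comm (Complex.I • (C - E))ᴴ]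
  simp only [Matrix.trace, Matrix.diag, Matrix.zero_mul, add_zero, zero_add, Matrix.diagonal_mul,
    Complex.add_re, Complex.re_sum, Matrix.mul_apply (N := (C + E)ᴴ),
    Matrix.mul_apply (N := (Complex.I • (C - E))ᴴ), ← Finset.sum_add_distrib, Finset.mul_sum]
  -- Parallelogram law: |c + e|² + |i(c - e)|² = 2(|c|² + |e|²).
  refine Finset.sum_congr rfl fun j _ => Finset.sum_congr rfl fun l _ => ?_
  simp [Complex.normSq_apply]
  ring

/-- The quadratic form of a symmetric matrix on the span of the vectors `u + iv`. -/
theorem quadratic_of_holomorphic {n : ℕ} {P M : Matrix (Fin n ⊕ Fin n) (Fin n ⊕ Fin n) ℝ}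
    (hP : P.IsSymm) (C : Matrix (Fin n) ι ℂ) :
    (toComplex M * pairing n * fromRows C (0 : Matrix (Fin n) ι ℂ))ᴴ * toComplex P *
      (toComplex M * pairing n * fromRows C (0 : Matrix (Fin n) ι ℂ)) = Cᴴ * hermPart (Mᵀ * P * M) * C := by
  have hN : (Mᵀ * P * M)ᵀ = Mᵀ * P * M := by
    simp [Matrix.transpose_mul, hP.eq, Matrix.mul_assoc]
  have h1 : (toComplex M * pairing n * fromRows C (0 : Matrix (Fin n) ι ℂ))ᴴ * toComplex P *
      (toComplex M * pairing n * fromRows C (0 : Matrix (Fin n) ι ℂ)) =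
      (pairing n * fromRows C (0 : Matrix (Fin n) ι ℂ))ᴴ * toComplex (Mᵀ * P * M) * (pairing n * fromRows C (0 : Matrix (Fin n) ι ℂ)) := by
    rw [Matrix.mul_assoc (toComplex M), conjTranspose_mul, toComplex_mul, toComplex_mul,
      conjTranspose_toComplex]
    simp only [Matrix.mul_assoc]
  rw [h1]
  generalize Mᵀ * P * M = N at hN
  have h2 : toComplex N = fromBlocks (toComplex N.toBlocks₁₁) (toComplex N.toBlocks₁₂)
      (toComplex N.toBlocks₁₂ᵀ) (toComplex N.toBlocks₂₂) := by
    ext i j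
    rcases i with i | i <;> rcases j with j | j <;> try rfl
    exact congrArg (fun x : ℝ => (x : ℂ)) (congrFun (congrFun hN (Sum.inr i)) (Sum.inl j)).symm
  have h3 : hermPart N = toComplex N.toBlocks₁₁ + toComplex N.toBlocks₂₂ +
      Complex.I • (toComplex N.toBlocks₁₂ - toComplex N.toBlocks₁₂ᵀ) := by
    ext i j
    simp [hermPart, toComplex]
  rw [h2, h3, pairing_mul_fromRows, Matrix.mul_assoc, fromBlocks_mul_fromRows,
    conjTranspose_fromRows_eq_fromCols_conjTranspose, fromCols_mul_fromRows]
  simp only [add_zero, sub_zero, conjTranspose_smul, Matrix.mul_add, Matrix.add_mul,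
    Matrix.mul_smul, Matrix.smul_mul, Matrix.mul_sub, Matrix.sub_mul, smul_smul,
    Matrix.mul_assoc, smul_sub]
  simp
  abel

end

/-! ### Existence in Williamson's theorem -/

section
variable {κ ι : Type*} [Fintype κ] [DecidableEq κ] [Fintype ι] [DecidableEq ι]

open scoped MatrixOrder in
theorem Matrix.PosDef.exists_transpose_mul_self {P : Matrix κ κ ℝ} (hP : P.PosDef) :
    ∃ R : Matrix κ κ ℝ, IsUnit R.det ∧ P = Rᵀ * R := by
  obtain ⟨R, hR⟩ := CStarAlgebra.nonneg_iff_eq_star_mul_self.1 hP.posSemidef.nonneg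
  have hR' : P = Rᵀ * R := hR
  refine ⟨R, ?_, hR'⟩
  have := hP.det_pos
  rw [hR', det_mul, det_transpose] at this
  exact isUnit_iff_ne_zero.2 fun h => by simp [h] at this

/-- Eigenvectors of a purely imaginary Hermitian matrix whose eigenvalues do not sum to zero: each
of them is orthogonal to the complex conjugate of the other. -/
theorem eigenvectors_dotProduct_eq_zero {H : Matrix κ κ ℂ} (hHT : Hᵀ = -H) (hH : H.IsHermitian)
    {i j : κ}
    (hij : hH.eigenvalues i + hH.eigenvalues j ≠ 0) :
    ∑ k, (hH.eigenvectorUnitary : Matrix κ κ ℂ) k i *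
      (hH.eigenvectorUnitary : Matrix κ κ ℂ) k j = 0 := by
  set v := (hH.eigenvectorBasis i : κ → ℂ)
  set w := (hH.eigenvectorBasis j : κ → ℂ)
  -- The bilinear, not sesquilinear, form vᵀHw is evaluated with H acting on either side; Hᵀ = -H
  -- produces the sign.
  have h1 : v ⬝ᵥ (H *ᵥ w) = (hH.eigenvalues j : ℂ) * (v ⬝ᵥ w) := by
    rw [hH.mulVec_eigenvectorBasis j, dotProduct_smul, Complex.real_smul]
  have h2 : v ⬝ᵥ (H *ᵥ w) = -((hH.eigenvalues i : ℂ) * (v ⬝ᵥ w)) := by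
    rw [dotProduct_mulVec, ← mulVec_transpose, hHT, neg_mulVec, hH.mulVec_eigenvectorBasis i,
      neg_dotProduct, smul_dotProduct, Complex.real_smul]
  have h3 : ((hH.eigenvalues i + hH.eigenvalues j : ℝ) : ℂ) * (v ⬝ᵥ w) = 0 := by
    push_cast
    linear_combination h1.symm.trans h2
  exact (mul_eq_zero.1 h3).resolve_left (by exact_mod_cast hij)

/-- The chosen eigenvectors are orthogonal to all of their complex conjugates (here `Vᴴᵀ`), so
together with these they form an orthonormal family of twice the size. -/
theorem two_mul_card_le_of_isotropic {H : Matrix κ κ ℂ} (hHT : Hᵀ = -H) (hH : H.IsHermitian)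
    {g : ι → κ} (hg : Function.Injective g)
    (hgs : ∀ i j, hH.eigenvalues (g i) + hH.eigenvalues (g j) ≠ 0) :
    2 * Fintype.card ι ≤ Fintype.card κ := by
  set V := (hH.eigenvectorUnitary : Matrix κ κ ℂ).submatrix id g with hV
  have h1 : Vᴴ * V = 1 := by
    rw [hV, conjTranspose_submatrix, ← Matrix.submatrix_mul _ _ g id g Function.bijective_id,
      hH.eigenvectorUnitary_conjTranspose_mul, Matrix.submatrix_one g hg]
  have h2 : Vᵀ * V = 0 := by
    ext i j
    simpa [Matrix.mul_apply, hV] using eigenvectors_dotProduct_eq_zero hHT hH (hgs i j)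
  have h3 : Vᴴ * Vᴴᵀ = 0 := by
    have := congrArg Matrix.conjTranspose h2
    rwa [conjTranspose_mul, conjTranspose_zero] at this
  have h4 : Vᴴᵀᴴ * Vᴴᵀ = 1 := by
    have h5 : Vᴴᵀᴴ = Vᵀ := by ext; simp
    rw [h5, ← Matrix.transpose_mul, h1, Matrix.transpose_one]
  have h5 : Vᴴᵀᴴ * V = 0 := by
    have h5 : Vᴴᵀᴴ = Vᵀ := by ext; simp
    rw [h5, h2]
  have hZ : (fromCols V Vᴴᵀ)ᴴ * fromCols V Vᴴᵀ = 1 := by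
    rw [conjTranspose_fromCols_eq_fromRows_conjTranspose, fromRows_mul_fromCols, h1, h3, h4, h5,
      fromBlocks_one]
  have hr := Matrix.rank_mul_le_left (fromCols V Vᴴᵀ)ᴴ (fromCols V Vᴴᵀ)
  rw [hZ, Matrix.rank_one, Fintype.card_sum] at hr
  have := hr.trans (Matrix.rank_le_card_width _)
  omega

/-- The normal form of an invertible real skew matrix. -/
theorem exists_skew_normal_form {n : ℕ} {T : Matrix (Fin n ⊕ Fin n) (Fin n ⊕ Fin n) ℝ}
    (hT : Tᵀ = -T) (hdet : T.det ≠ 0) :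
    ∃ (O : Matrix (Fin n ⊕ Fin n) (Fin n ⊕ Fin n) ℝ) (lam : Fin n → ℝ), (∀ j, 0 < lam j) ∧
      Oᵀ * O = 1 ∧ Oᵀ * T * O = fromBlocks 0 (diagonal lam) (-diagonal lam) 0 := by
  obtain ⟨H, hHdef⟩ : ∃ H, H = (-Complex.I) • toComplex T := ⟨_, rfl⟩
  have hHT : Hᵀ = -H := by
    ext a b
    have := congrFun (congrFun hT a) b
    simp only [Matrix.transpose_apply, Matrix.neg_apply] at this
    simp [hHdef, toComplex, this]
  have hH : H.IsHermitian := by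
    rw [hHdef, Matrix.IsHermitian, conjTranspose_smul, conjTranspose_toComplex, hT]
    ext; simp [toComplex]
  have hne : ∀ i, hH.eigenvalues i ≠ 0 := by
    intro i hi
    have h1 := hH.det_eq_prod_eigenvalues
    rw [Finset.prod_eq_zero (Finset.mem_univ i) (by rw [hi]; exact RCLike.ofReal_zero), hHdef,
      det_smul] at h1
    have h2 : (toComplex T).det = (T.det : ℂ) := (RingHom.map_det Complex.ofRealHom T).symm
    rw [h2] at h1
    rcases mul_eq_zero.1 h1 with h | h
    · exact pow_ne_zero _ (neg_ne_zero.2 Complex.I_ne_zero) h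
    · exact hdet (by exact_mod_cast h)
  -- Positive and negative eigenvalues each number at most n. None is zero and there are 2n in all,
  -- so exactly n are positive.
  have hcp : 2 * Fintype.card {i // 0 < hH.eigenvalues i} ≤ Fintype.card (Fin n ⊕ Fin n) :=
    two_mul_card_le_of_isotropic hHT hH Subtype.val_injective
      fun i j => (add_pos i.2 j.2).ne'
  have hcn : 2 * Fintype.card {i // ¬ 0 < hH.eigenvalues i} ≤ Fintype.card (Fin n ⊕ Fin n) :=
    two_mul_card_le_of_isotropic hHT hH Subtype.val_injective fun i j =>
      (add_neg (lt_of_le_of_ne (not_lt.1 i.2) (hne _)) (lt_of_le_of_ne (not_lt.1 j.2) (hne _))).ne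
  have hc := Fintype.card_subtype_compl fun i => 0 < hH.eigenvalues i
  have hcs := Fintype.card_subtype_le fun i => 0 < hH.eigenvalues i
  have hcard : Fintype.card {i // 0 < hH.eigenvalues i} = n := by
    rw [Fintype.card_sum, Fintype.card_fin] at *
    omega
  let e : Fin n ≃ {i // 0 < hH.eigenvalues i} := (Fintype.equivFinOfCardEq hcard).symm
  set V := (hH.eigenvectorUnitary : Matrix (Fin n ⊕ Fin n) (Fin n ⊕ Fin n) ℂ) with hV
  let lam : Fin n → ℝ := fun j => hH.eigenvalues (e j)
  have hlam : ∀ j, 0 < lam j := fun j => (e j).2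
  let X : Matrix (Fin n ⊕ Fin n) (Fin n) ℝ := fun i j => (V i (e j)).re
  let Y : Matrix (Fin n ⊕ Fin n) (Fin n) ℝ := fun i j => (V i (e j)).im
  have hort : ∀ j k, ∑ i, star (V i (e j)) * V i (e k) = if j = k then 1 else 0 := by
    intro j k
    have := congrFun (congrFun hH.eigenvectorUnitary_conjTranspose_mul (e j)) (e k)
    simpa [Matrix.mul_apply, Matrix.one_apply, Subtype.val_inj, hV, -Fintype.sum_sum_type]
      using this
  have hiso : ∀ j k, ∑ i, V i (e j) * V i (e k) = 0 := fun j k =>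
    eigenvectors_dotProduct_eq_zero hHT hH (add_pos (hlam j) (hlam k)).ne'
  -- Orthonormality combined with isotropy of X + iY shows that the columns of X and Y are mutually
  -- orthogonal, of squared norm 1/2; hence the factor √2 in the final witness.
  have hre : ∀ j k, (Xᵀ * X) j k = (if j = k then 1 / 2 else 0) ∧
      (Yᵀ * Y) j k = (if j = k then 1 / 2 else 0) ∧ (Xᵀ * Y) j k = 0 ∧ (Yᵀ * X) j k = 0 := by
    intro j k
    have a1 := congrArg Complex.re (hort j k)
    have a2 := congrArg Complex.im (hort j k)
    have a3 := congrArg Complex.re (hiso j k)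
    have a4 := congrArg Complex.im (hiso j k)
    simp only [Complex.re_sum, Complex.im_sum, Complex.mul_re, Complex.mul_im, Complex.star_def,
      Complex.conj_re, Complex.conj_im, Finset.sum_add_distrib, Finset.sum_sub_distrib, neg_mul,
      Finset.sum_neg_distrib, Complex.zero_re, Complex.zero_im] at a1 a2 a3 a4
    simp only [Matrix.mul_apply, Matrix.transpose_apply]
    simp only [X, Y]
    split_ifs at a1 a2 ⊢ <;> simp [-Fintype.sum_sum_type] at a1 a2 <;> refine ⟨?_, ?_, ?_, ?_⟩ <;> linarith
  have hXX : Xᵀ * X = (1 / 2 : ℝ) • 1 := by ext j k; simp [(hre j k).1, Matrix.one_apply]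
  have hYY : Yᵀ * Y = (1 / 2 : ℝ) • 1 := by ext j k; simp [(hre j k).2.1, Matrix.one_apply]
  have hXY : Xᵀ * Y = 0 := by ext j k; simp [(hre j k).2.2.1]
  have hYX : Yᵀ * X = 0 := by ext j k; simp [(hre j k).2.2.2]
  have heig : ∀ i j, ∑ k, (T i k : ℂ) * V k (e j) = Complex.I * lam j * V i (e j) := by
    intro i j
    have hHi : ∀ k, H i k = -Complex.I * (T i k : ℂ) := fun k => by rw [hHdef]; rfl
    have : ∑ k, H i k * V k (e j) = (lam j : ℂ) * V i (e j) :=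
      congrFun (hH.mulVec_eigenvectorBasis (e j)) i
    simp only [hHi, mul_assoc, ← Finset.mul_sum] at this
    have h2 := congrArg (fun z => Complex.I * z) this
    simp only [← mul_assoc, mul_neg, neg_mul, Complex.I_mul_I, neg_neg, one_mul] at h2
    exact h2
  have hTX : T * X = -(Y * diagonal lam) := by
    ext i j
    have := congrArg Complex.re (heig i j)
    simp [Complex.mul_re, -Fintype.sum_sum_type] at this
    rw [Matrix.neg_apply, Matrix.mul_diagonal, Matrix.mul_apply]
    simp only [X, Y]
    linarith
  have hTY : T * Y = X * diagonal lam := by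
    ext i j
    have := congrArg Complex.im (heig i j)
    simp [Complex.mul_im, -Fintype.sum_sum_type] at this
    rw [Matrix.mul_diagonal, Matrix.mul_apply]
    simp only [X, Y]
    linarith
  have hs : √2 * √2 = (2 : ℝ) := Real.mul_self_sqrt (by norm_num)
  refine ⟨√2 • fromCols X Y, lam, hlam, ?_, ?_⟩
  · rw [Matrix.transpose_smul, Matrix.smul_mul, Matrix.mul_smul, smul_smul, hs,
      transpose_fromCols, fromRows_mul_fromCols, hXX, hXY, hYX, hYY, fromBlocks_smul, smul_smul,
      smul_zero]
    norm_num
  · rw [Matrix.transpose_smul, Matrix.smul_mul, Matrix.smul_mul, Matrix.mul_smul, smul_smul, hs,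
      transpose_fromCols, Matrix.mul_assoc, mul_fromCols, hTX, hTY, fromRows_mul_fromCols,
      Matrix.mul_neg, Matrix.mul_neg, ← Matrix.mul_assoc, ← Matrix.mul_assoc, ← Matrix.mul_assoc,
      ← Matrix.mul_assoc, hXX, hXY, hYX, hYY, fromBlocks_smul]
    simp [smul_smul]

end

theorem fromBlocks_diag_reindex {n : ℕ} (σ : Equiv.Perm (Fin n))
    (M X : Matrix (Fin n ⊕ Fin n) (Fin n ⊕ Fin n) ℝ) :
    (M.submatrix id (Sum.map σ σ))ᵀ * X * M.submatrix id (Sum.map σ σ) =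
      (Mᵀ * X * M).submatrix (Sum.map σ σ) (Sum.map σ σ) := by
  ext i j; simp [Matrix.mul_apply]

/-- Williamson's theorem: existence of the normal form. -/
theorem exists_isWilliamson {n : ℕ} {P : Matrix (Fin n ⊕ Fin n) (Fin n ⊕ Fin n) ℝ}
    (hP : P.PosDef) : ∃ d, IsWilliamson P d := by
  obtain ⟨R, hR, rfl⟩ := hP.exists_transpose_mul_self
  have hRi : R * R⁻¹ = 1 := Matrix.mul_nonsing_inv _ hR
  have hRt : (R⁻¹)ᵀ * Rᵀ = 1 := by rw [← Matrix.transpose_mul, hRi, Matrix.transpose_one]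
  have hJt : (sympJ n)ᵀ = -sympJ n := by
    simp [sympJ, fromBlocks_transpose, fromBlocks_neg]
  have hJdet : (sympJ n).det ≠ 0 := by
    have : sympJ n * (-sympJ n) = 1 := by
      simp [sympJ, fromBlocks_neg, fromBlocks_multiply]
    intro h
    have h2 := congrArg Matrix.det this
    rw [det_mul, h, zero_mul, det_one] at h2
    exact zero_ne_one h2
  have hRdet : (R⁻¹).det ≠ 0 := by
    intro h
    have h2 := congrArg Matrix.det hRi
    rw [det_mul, h, mul_zero, det_one] at h2
    exact zero_ne_one h2
  obtain ⟨O, lam, hlam, hO, hOT⟩ := exists_skew_normal_form (T := (R⁻¹)ᵀ * sympJ n * R⁻¹)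
    (by simp [Matrix.transpose_mul, hJt, Matrix.mul_assoc])
    (by
      rw [det_mul, det_mul, det_transpose]
      exact mul_ne_zero (mul_ne_zero hRdet hJdet) hRdet)
  -- Scaling by λ^(-1/2) on both halves turns the skew normal form into J and the identity into
  -- diag(1/λ, 1/λ).
  let s : Fin n → ℝ := fun j => (√(lam j))⁻¹
  have hss : ∀ j, s j * s j = (lam j)⁻¹ := fun j => by
    simp only [s]; rw [← mul_inv, Real.mul_self_sqrt (hlam j).le]
  let S : Matrix (Fin n ⊕ Fin n) (Fin n ⊕ Fin n) ℝ := fromBlocks (diagonal s) 0 0 (diagonal s)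
  have hSt : Sᵀ = S := by simp [S]
  let M := R⁻¹ * O * S
  have hMP : Mᵀ * (Rᵀ * R) * M =
      fromBlocks (diagonal fun j => (lam j)⁻¹) 0 0 (diagonal fun j => (lam j)⁻¹) := by
    have : Mᵀ * (Rᵀ * R) * M = Sᵀ * (Oᵀ * (((R⁻¹)ᵀ * Rᵀ) * (R * R⁻¹)) * O) * S := by
      simp only [M, Matrix.transpose_mul, Matrix.mul_assoc]
    rw [this, hRt, hRi, Matrix.mul_one, Matrix.mul_one, hO, Matrix.mul_one, hSt]
    simp [S, diagonal_mul_diagonal, hss]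
  have hMJ : Mᵀ * sympJ n * M = sympJ n := by
    have : Mᵀ * sympJ n * M = Sᵀ * (Oᵀ * ((R⁻¹)ᵀ * sympJ n * R⁻¹) * O) * S := by
      simp only [M, Matrix.transpose_mul, Matrix.mul_assoc]
    rw [this, hOT, hSt]
    have hsl : ∀ j, s j * lam j * s j = 1 := fun j => by
      rw [mul_right_comm, hss, inv_mul_cancel₀ (hlam j).ne']
    simp only [S, fromBlocks_multiply, diagonal_mul_diagonal, Matrix.mul_zero, Matrix.zero_mul,
      Matrix.mul_neg, Matrix.neg_mul, add_zero, zero_add, neg_zero, sympJ, hsl, diagonal_one]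
  -- Permuting the u-columns and v-columns alike sorts the diagonal and preserves J.
  let σ := Tuple.sort fun j => (lam j)⁻¹
  refine ⟨(fun j => (lam j)⁻¹) ∘ σ, Tuple.monotone_sort _, fun j => inv_pos.2 (hlam _),
    M.submatrix id (Sum.map σ σ), ?_, ?_⟩
  · rw [fromBlocks_diag_reindex, hMJ]
    ext i j
    rcases i with i | i <;> rcases j with j | j <;> simp [sympJ, Matrix.one_apply]
  · rw [fromBlocks_diag_reindex, hMP]
    ext i j
    rcases i with i | i <;> rcases j with j | j <;> simp [Matrix.diagonal_apply]

theorem isWilliamson_sympEigFin {n : ℕ} {P : Matrix (Fin n ⊕ Fin n) (Fin n ⊕ Fin n) ℝ}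
    (hP : P.PosDef) : IsWilliamson P (sympEigFin P) := by
  have h := exists_isWilliamson hP
  rw [sympEigFin, dif_pos h]
  exact h.choose_spec

theorem sum_sympEig_eq {n m : ℕ} (hmn : m ≤ n) (P : Matrix (Fin n ⊕ Fin n) (Fin n ⊕ Fin n) ℝ) :
    ∑ j ∈ Finset.Icc 1 m, sympEig P j = ∑ j : Fin m, sympEigFin P (Fin.castLE hmn j) := by
  have h1 : ∑ j ∈ Finset.Icc 1 m, sympEig P j = ∑ j ∈ Finset.range m, sympEig P (j + 1) := by
    rw [Finset.range_eq_Ico, Finset.sum_Ico_add' (fun j => sympEig P j) 0 m 1]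
    rfl
  rw [h1, ← Fin.sum_univ_eq_sum_range (fun j => sympEig P (j + 1))]
  refine Finset.sum_congr rfl fun j _ => ?_
  rw [sympEig, dif_pos ⟨by omega, by omega⟩]
  rfl

theorem sympEig_succ {n : ℕ} (P : Matrix (Fin n ⊕ Fin n) (Fin n ⊕ Fin n) ℝ) (j : Fin n) :
    sympEig P (j + 1) = sympEigFin P j := by
  rw [sympEig, dif_pos ⟨by omega, by omega⟩]
  rfl

/-! ### Trace minimization and the index block of d_m -/

section
variable {ι : Type*} [Fintype ι] [DecidableEq ι] {n m : ℕ}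

/-- Trace minimization: the lower bound. -/
theorem two_mul_sum_sympEig_le (hmn : m ≤ n) {P : Matrix (Fin n ⊕ Fin n) (Fin n ⊕ Fin n) ℝ}
    (hP : P.PosDef) (hι : Fintype.card ι = m) {X : Matrix (Fin n ⊕ Fin n) ι ℂ}
    (hX : Xᴴ * hermJ n * X = (2 : ℂ) • 1) :
    2 * ∑ j ∈ Finset.Icc 1 m, sympEig P j ≤ (Xᴴ * toComplex P * X).trace.re := by
  obtain ⟨hd, hpos, M, hMJ, hMP⟩ := isWilliamson_sympEigFin hP
  obtain ⟨C, E, rfl, hCE⟩ := exists_coordinates hMJ hX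
  rw [re_trace_of_diagonal hMP, sum_sympEig_eq hmn]
  exact mul_le_mul_of_nonneg_left (sum_castLE_le_of_indefinite hmn hd hpos hι hCE) zero_le_two

/-- Trace minimization: the bound is attained. -/
theorem exists_re_trace_eq (hmn : m ≤ n) {P : Matrix (Fin n ⊕ Fin n) (Fin n ⊕ Fin n) ℝ}
    (hP : P.PosDef) : ∃ X : Matrix (Fin n ⊕ Fin n) (Fin m) ℂ,
      Xᴴ * hermJ n * X = (2 : ℂ) • 1 ∧
      (Xᴴ * toComplex P * X).trace.re = 2 * ∑ j ∈ Finset.Icc 1 m, sympEig P j := by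
  obtain ⟨hd, hpos, M, hMJ, hMP⟩ := isWilliamson_sympEigFin hP
  let C : Matrix (Fin n) (Fin m) ℂ := (1 : Matrix (Fin n) (Fin n) ℂ).submatrix id (Fin.castLE hmn)
  have hC : Cᴴ * C = 1 := by
    rw [conjTranspose_submatrix, ← Matrix.submatrix_mul _ _ _ id _ Function.bijective_id,
      conjTranspose_one, Matrix.one_mul, Matrix.submatrix_one _ (Fin.castLE_injective hmn)]
  refine ⟨toComplex M * pairing n * fromRows C (0 : Matrix (Fin n) (Fin m) ℂ),
    hermJ_of_coordinates hMJ (by simpa using hC), ?_⟩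
  rw [re_trace_of_diagonal hMP, sum_sympEig_eq hmn]
  congr 1
  have : ∀ j l, Complex.normSq (C j l) = if j = Fin.castLE hmn l then 1 else 0 := by
    intro j l
    simp only [C, Matrix.submatrix_apply, id, Matrix.one_apply]
    split_ifs <;> simp
  simp only [this, Matrix.zero_apply, map_zero, Finset.sum_const_zero, add_zero, Finset.mul_sum]
  rw [Finset.sum_comm]
  simp

/-- A level set of a monotone sequence is an interval [k0, k1]; the two counts are then m - k0 + 1
and k1 - m. -/
theorem exists_index_block {f : ℕ → ℝ} (hm : 1 ≤ m) (hmn : m ≤ n)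
    (hf : ∀ j k, 1 ≤ j → j ≤ k → k ≤ n → f j ≤ f k) {k : ℕ} (hk : 1 ≤ k) (hkn : k ≤ n) :
    f k = f m ↔ m - Finset.card {k ∈ Finset.Icc 1 m | f k = f m} < k ∧
      k ≤ m + Finset.card {k ∈ Finset.Icc (m + 1) n | f k = f m} := by
  set R := {k ∈ Finset.Icc 1 n | f k = f m} with hR
  have hmR : m ∈ R := by simp [hR, hm, hmn]
  set k0 := R.min' ⟨m, hmR⟩ with hk0
  set k1 := R.max' ⟨m, hmR⟩ with hk1
  have h0 : k0 ∈ R := R.min'_mem _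
  have h1 : k1 ∈ R := R.max'_mem _
  have h0m : k0 ≤ m := R.min'_le m hmR
  have h1m : m ≤ k1 := R.le_max' m hmR
  simp only [hR, Finset.mem_filter, Finset.mem_Icc] at h0 h1
  have hmem : ∀ j, 1 ≤ j → j ≤ n → (f j = f m ↔ k0 ≤ j ∧ j ≤ k1) := by
    intro j hj hjn
    constructor
    · intro h
      have : j ∈ R := by simp [hR, hj, hjn, h]
      exact ⟨R.min'_le j this, R.le_max' j this⟩
    · rintro ⟨ha, hb⟩
      refine le_antisymm ?_ ?_
      · rw [← h1.2]; exact hf _ _ hj hb h1.1.2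
      · rw [← h0.2]; exact hf _ _ h0.1.1 ha hjn
  have hS : {k ∈ Finset.Icc 1 m | f k = f m} = Finset.Icc k0 m := by
    ext j
    simp only [Finset.mem_filter, Finset.mem_Icc]
    constructor
    · rintro ⟨⟨ha, hb⟩, hc⟩
      exact ⟨((hmem j ha (hb.trans hmn)).1 hc).1, hb⟩
    · rintro ⟨ha, hb⟩
      exact ⟨⟨h0.1.1.trans ha, hb⟩, (hmem j (h0.1.1.trans ha) (hb.trans hmn)).2 ⟨ha, hb.trans h1m⟩⟩
  have hT : {k ∈ Finset.Icc (m + 1) n | f k = f m} = Finset.Icc (m + 1) k1 := by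
    ext j
    simp only [Finset.mem_filter, Finset.mem_Icc]
    constructor
    · rintro ⟨⟨ha, hb⟩, hc⟩
      exact ⟨ha, ((hmem j (by omega) hb).1 hc).2⟩
    · rintro ⟨ha, hb⟩
      exact ⟨⟨ha, hb.trans h1.1.2⟩, (hmem j (by omega) (hb.trans h1.1.2)).2 ⟨by omega, hb⟩⟩
  rw [hmem k hk hkn, hS, hT, Nat.card_Icc, Nat.card_Icc]
  omega

theorem sympEigFin_eq_iff (hm : 1 ≤ m) (hmn : m ≤ n)
    {A : Matrix (Fin n ⊕ Fin n) (Fin n ⊕ Fin n) ℝ} (hd : Monotone (sympEigFin A)) (j : Fin n) :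
    sympEigFin A j = sympEigFin A ⟨m - 1, by omega⟩ ↔
      m - iIdx A m ≤ j ∧ (j : ℕ) < m - iIdx A m + rIdx A m := by
  have hf : ∀ j k, 1 ≤ j → j ≤ k → k ≤ n → sympEig A j ≤ sympEig A k := by
    intro j k hj hjk hk
    rw [sympEig, sympEig, dif_pos ⟨hj, by omega⟩, dif_pos ⟨by omega, hk⟩]
    exact hd (by rw [Fin.le_def]; show j - 1 ≤ k - 1; omega)
  have h1 := exists_index_block hm hmn hf (k := j + 1) (by omega) (by omega)
  have h2 : sympEig A m = sympEigFin A ⟨m - 1, by omega⟩ := by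
    rw [sympEig, dif_pos ⟨hm, hmn⟩]
  rw [← h2, ← sympEig_succ, h1]
  have h3 := iIdx_le A m
  unfold rIdx
  change m - iIdx A m < (j : ℕ) + 1 ∧ (j : ℕ) + 1 ≤ m + jIdx A m ↔ _
  omega

theorem one_le_iIdx (hm : 1 ≤ m) (A : Matrix (Fin n ⊕ Fin n) (Fin n ⊕ Fin n) ℝ) :
    1 ≤ iIdx A m := by
  rw [iIdx, Finset.one_le_card]
  exact ⟨m, by simp [hm]⟩

theorem lt_of_lt_block (hm : 1 ≤ m) (hmn : m ≤ n)
    {A : Matrix (Fin n ⊕ Fin n) (Fin n ⊕ Fin n) ℝ} (hd : Monotone (sympEigFin A)) {j : Fin n}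
    (hj : (j : ℕ) < m - iIdx A m) : sympEigFin A j < sympEigFin A ⟨m - 1, by omega⟩ := by
  have := one_le_iIdx hm A
  refine lt_of_le_of_ne (hd (by rw [Fin.le_def]; show (j : ℕ) ≤ m - 1; omega)) fun h => ?_
  have := ((sympEigFin_eq_iff hm hmn hd j).1 h).1
  omega

theorem lt_of_block_le (hm : 1 ≤ m) (hmn : m ≤ n)
    {A : Matrix (Fin n ⊕ Fin n) (Fin n ⊕ Fin n) ℝ} (hd : Monotone (sympEigFin A)) {j : Fin n}
    (hj : m - iIdx A m + rIdx A m ≤ (j : ℕ)) :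
    sympEigFin A ⟨m - 1, by omega⟩ < sympEigFin A j := by
  have h1 := iIdx_le A m
  have h2 : rIdx A m = iIdx A m + jIdx A m := rfl
  refine lt_of_le_of_ne (hd (by rw [Fin.le_def]; show m - 1 ≤ (j : ℕ); omega)) fun h => ?_
  have := ((sympEigFin_eq_iff hm hmn hd j).1 h.symm).2
  omega

/-- The symplectic eigenvector equations say that `M` is symplectic and diagonalizes `A`. -/
theorem symplectic_of_mem_SpEig {A M : Matrix (Fin n ⊕ Fin n) (Fin n ⊕ Fin n) ℝ}
    (hM : M ∈ SpEig n A) : Mᵀ * sympJ n * M = sympJ n ∧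
      Mᵀ * A * M = fromBlocks (diagonal (sympEigFin A)) 0 0 (diagonal (sympEigFin A)) := by
  obtain ⟨h1, h2⟩ := hM
  have hJt : (sympJ n)ᵀ = -sympJ n := by
    simp [sympJ, fromBlocks_transpose, fromBlocks_neg]
  have hskew : ∀ x y : Fin n ⊕ Fin n → ℝ,
      x ⬝ᵥ (sympJ n *ᵥ y) = -(y ⬝ᵥ (sympJ n *ᵥ x)) := by
    intro x y
    rw [dotProduct_mulVec, ← mulVec_transpose, hJt, neg_mulVec, neg_dotProduct, dotProduct_comm]
  have hent : ∀ (N : Matrix (Fin n ⊕ Fin n) (Fin n ⊕ Fin n) ℝ) i j,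
      (Mᵀ * N * M) i j = M.col i ⬝ᵥ (N *ᵥ M.col j) := by
    intro N i j
    rw [Matrix.mul_assoc]
    rfl
  have hvu : ∀ j k : Fin n, M.col (Sum.inr j) ⬝ᵥ (sympJ n *ᵥ M.col (Sum.inl k)) =
      if j = k then -1 else 0 := by
    intro j k
    rw [hskew, (h1 k j).2.2]
    by_cases h : j = k
    · simp [h]
    · rw [if_neg h, if_neg (Ne.symm h), neg_zero]
  constructor
  · ext i j
    rw [hent]
    rcases i with i | i <;> rcases j with j | j
    · rw [(h1 i j).1]; simp [sympJ]
    · rw [(h1 i j).2.2]; simp [sympJ, Matrix.one_apply]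
    · rw [hvu]; by_cases h : i = j <;> simp [sympJ, h]
    · rw [(h1 i j).2.1]; simp [sympJ]
  · ext i j
    rw [hent]
    rcases i with i | i <;> rcases j with j | j
    · rw [(h2 j).1, dotProduct_smul, (h1 i j).2.2, sympEig_succ]
      by_cases h : i = j <;> simp [h]
    · rw [(h2 j).2, dotProduct_smul, (h1 i j).1]; simp
    · rw [(h2 j).1, dotProduct_smul, (h1 i j).2.1]; simp
    · rw [(h2 j).2, dotProduct_smul, hvu, sympEig_succ]
      by_cases h : i = j <;> simp [h]

theorem mul_sympCols_one {κ : Type*} (M : Matrix κ (Fin n ⊕ Fin n) ℝ) (a α : ℕ) (h : a + α ≤ n) :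
    M * sympCols (1 : Matrix (Fin n ⊕ Fin n) (Fin n ⊕ Fin n) ℝ) a α h = sympCols M a α h := by
  ext i j
  simp [sympCols, Matrix.mul_apply, Matrix.one_apply, -Fintype.sum_sum_type]

/-- The embedding of the indices `0, …, α - 1` as `a, …, a + α - 1`. -/
def blockIdx (a α : ℕ) (h : a + α ≤ n) : Fin α → Fin n := fun k => ⟨a + k, by omega⟩

theorem blockIdx_injective {a α : ℕ} (h : a + α ≤ n) : Function.Injective (blockIdx a α h) := by
  intro i j hij
  have := congrArg Fin.val hij
  simp only [blockIdx] at this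
  exact Fin.ext (by omega)

theorem sympCols_conj (B M : Matrix (Fin n ⊕ Fin n) (Fin n ⊕ Fin n) ℝ) (a α : ℕ) (h : a + α ≤ n) :
    (sympCols M a α h)ᵀ * B * sympCols M a α h = (Mᵀ * B * M).submatrix
      (Sum.map (blockIdx a α h) (blockIdx a α h)) (Sum.map (blockIdx a α h) (blockIdx a α h)) := by
  ext i j
  simp only [Matrix.mul_apply, sympCols, Matrix.transpose_apply, Matrix.submatrix_apply, id]
  rfl

/-- `hermPart` commutes with selecting matching u- and v-columns, so both terms of the derivative
can be read from the single Hermitian matrix `hermPart (Mᵀ * B * M)`. -/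
theorem Btt_eq (A M B : Matrix (Fin n ⊕ Fin n) (Fin n ⊕ Fin n) ℝ) (hmn : m ≤ n) :
    Btt A M B hmn = -(hermPart (Mᵀ * B * M)).submatrix
      (blockIdx (m - iIdx A m) (rIdx A m) (tilde_bound A hmn))
      (blockIdx (m - iIdx A m) (rIdx A m) (tilde_bound A hmn)) := by
  rw [Btt, Btilde, Mtilde, mul_sympCols_one, sympCols_conj]
  ext i j
  simp [hermPart, Matrix.toBlocks₁₁, Matrix.toBlocks₂₂, Matrix.toBlocks₁₂]
  ring

/-- The skew part C₁₂ - C₁₂ᵀ has zero diagonal, so `hermPart` keeps the trace. -/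
theorem trace_Bbar_eq (A M B : Matrix (Fin n ⊕ Fin n) (Fin n ⊕ Fin n) ℝ) (hmn : m ≤ n) :
    (Bbar A M B hmn).trace = -(∑ k, hermPart (Mᵀ * B * M)
      (blockIdx 0 (m - iIdx A m) (bar_bound A hmn) k)
      (blockIdx 0 (m - iIdx A m) (bar_bound A hmn) k)).re := by
  rw [Bbar, Mbar, mul_sympCols_one, sympCols_conj, Matrix.trace_neg]
  simp [Matrix.trace, hermPart, Matrix.toBlocks₁₁, Matrix.toBlocks₂₂, Matrix.toBlocks₁₂,
    Finset.sum_add_distrib]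

theorem sum_blocks {R : Type*} [AddCommMonoid R] {a r : ℕ} (h0 : 0 + a ≤ n) (h : a + r ≤ n)
    {f : Fin n → R} (hf : ∀ j : Fin n, a + r ≤ (j : ℕ) → f j = 0) :
    ∑ j, f j = ∑ k, f (blockIdx 0 a h0 k) + ∑ k, f (blockIdx a r h k) := by
  obtain ⟨s, rfl⟩ := Nat.exists_eq_add_of_le h
  rw [Fin.sum_univ_add, Fin.sum_univ_add, Finset.sum_eq_zero (s := (Finset.univ : Finset (Fin s)))
    fun j _ => hf _ (by simp), add_zero]
  congr 1
  exact Finset.sum_congr rfl fun k _ => congrArg f (Fin.ext (by simp [blockIdx]))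

end

/-! ### Compression to the free block -/

section
open scoped ComplexOrder
variable {κ ι : Type*} [Fintype ι]

theorem projection_apply_self (C : Matrix κ ι ℂ) (j : κ) :
    (C * Cᴴ) j j = ((∑ l, Complex.normSq (C j l) : ℝ) : ℂ) := by
  simp [Matrix.mul_apply, Complex.mul_conj]

theorem projection_apply_of_diag_eq_zero {C : Matrix κ ι ℂ} {j : κ}
    (hj : ∑ l, Complex.normSq (C j l) = 0) (k : κ) :
    (C * Cᴴ) j k = 0 ∧ (C * Cᴴ) k j = 0 := by
  have h : ∀ l, C j l = 0 := fun l => Complex.normSq_eq_zero.1 ((Finset.sum_eq_zero_iff_of_nonneg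
    fun l _ => Complex.normSq_nonneg _).1 hj l (Finset.mem_univ l))
  constructor <;> simp [Matrix.mul_apply, h]

variable [Fintype κ] [DecidableEq ι]

theorem projection_mul_self {C : Matrix κ ι ℂ} (hC : Cᴴ * C = 1) :
    (C * Cᴴ) * (C * Cᴴ) = C * Cᴴ := by
  rw [Matrix.mul_assoc, ← Matrix.mul_assoc Cᴴ, hC, Matrix.one_mul]

/-- For a projection Q, Q_jj is the sum of |Q_jk|² over k; if Q_jj = 1, the diagonal term exhausts
it. -/
theorem projection_apply_of_diag_eq_one [DecidableEq κ] {C : Matrix κ ι ℂ} (hC : Cᴴ * C = 1) {j k : κ}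
    (hj : ∑ l, Complex.normSq (C j l) = 1) (hk : k ≠ j) : (C * Cᴴ) j k = 0 := by
  have hQh : (C * Cᴴ)ᴴ = C * Cᴴ := (isHermitian_mul_conjTranspose_self C).eq
  have h1 := mul_conjTranspose_self_apply_self (C * Cᴴ) j
  rw [hQh, projection_mul_self hC, projection_apply_self, Complex.ofReal_re, hj,
    ← Finset.add_sum_erase _ _ (Finset.mem_univ j), projection_apply_self, hj,
    Complex.ofReal_one, map_one, eq_comm, add_eq_left] at h1
  exact Complex.normSq_eq_zero.1 ((Finset.sum_eq_zero_iff_of_nonneg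
    fun l _ => Complex.normSq_nonneg _).1 h1 k (Finset.mem_erase.2 ⟨hk, Finset.mem_univ k⟩))

/-- The trace of the compression of `β` to a projection that is `1` on the first `a` coordinates
and `0` beyond the first `a + r` of them. -/
theorem trace_compression {n a r : ℕ} (h0 : 0 + a ≤ n) (h : a + r ≤ n) {C : Matrix (Fin n) ι ℂ}
    (hC : Cᴴ * C = 1) (h1 : ∀ j : Fin n, (j : ℕ) < a → ∑ l, Complex.normSq (C j l) = 1)
    (h2 : ∀ j : Fin n, a + r ≤ (j : ℕ) → ∑ l, Complex.normSq (C j l) = 0)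
    (β : Matrix (Fin n) (Fin n) ℂ) :
    (Cᴴ * β * C).trace = ∑ k, β (blockIdx 0 a h0 k) (blockIdx 0 a h0 k) +
      (β.submatrix (blockIdx a r h) (blockIdx a r h) *
        (C * Cᴴ).submatrix (blockIdx a r h) (blockIdx a r h)).trace := by
  set Q := C * Cᴴ with hQ
  have hQh : Qᴴ = Q := (isHermitian_mul_conjTranspose_self C).eq
  have hlow' : ∀ j k : Fin n, (j : ℕ) < a → k ≠ j → Q j k = 0 := fun j k hj hk =>
    projection_apply_of_diag_eq_one hC (h1 j hj) hk
  have hlow : ∀ j k : Fin n, (j : ℕ) < a → k ≠ j → Q k j = 0 := by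
    intro j k hj hk
    rw [← hQh, conjTranspose_apply, hlow' j k hj hk, star_zero]
  have hhigh : ∀ j k : Fin n, a + r ≤ (j : ℕ) → Q j k = 0 ∧ Q k j = 0 := fun j k hj =>
    projection_apply_of_diag_eq_zero (h2 j hj) k
  rw [Matrix.mul_assoc, Matrix.trace_mul_comm, Matrix.mul_assoc, ← hQ]
  have hdiag : ∀ j : Fin n, a + r ≤ (j : ℕ) → (β * Q) j j = 0 := by
    intro j hj
    rw [Matrix.mul_apply]
    exact Finset.sum_eq_zero fun k _ => by
      rw [(hhigh j k hj).2, mul_zero]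
  rw [Matrix.trace, sum_blocks h0 h (f := fun j => (β * Q).diag j) hdiag]
  congr 1
  · refine Finset.sum_congr rfl fun k _ => ?_
    have hk : ((blockIdx 0 a h0 k : Fin n) : ℕ) < a := by simp [blockIdx]
    rw [Matrix.diag_apply, Matrix.mul_apply, Finset.sum_eq_single (blockIdx 0 a h0 k)
      (fun j _ hj => by rw [hlow _ _ hk hj, mul_zero]) (by simp), hQ, projection_apply_self,
      h1 _ hk, Complex.ofReal_one, mul_one]
  · refine Finset.sum_congr rfl fun k _ => ?_
    rw [Matrix.diag_apply, Matrix.diag_apply, Matrix.mul_apply, Matrix.mul_apply,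
      sum_blocks h0 h (f := fun j => β (blockIdx a r h k) j * Q j (blockIdx a r h k))
        fun j hj => by rw [(hhigh j _ hj).1, mul_zero],
      Finset.sum_eq_zero (s := (Finset.univ : Finset (Fin a))), zero_add]
    · rfl
    · intro j _
      rw [hlow', mul_zero]
      · simp [blockIdx]
      · intro he
        have := congrArg Fin.val he
        simp only [blockIdx] at this
        omega

/-- The case β = 1 of `trace_compression` counts the rank left for the block. -/
theorem trace_projection_block {n a r : ℕ} (h0 : 0 + a ≤ n) (h : a + r ≤ n)
    {C : Matrix (Fin n) ι ℂ}
    (hC : Cᴴ * C = 1) (h1 : ∀ j : Fin n, (j : ℕ) < a → ∑ l, Complex.normSq (C j l) = 1)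
    (h2 : ∀ j : Fin n, a + r ≤ (j : ℕ) → ∑ l, Complex.normSq (C j l) = 0) :
    ((C * Cᴴ).submatrix (blockIdx a r h) (blockIdx a r h)).trace = Fintype.card ι - a := by
  have := trace_compression h0 h hC h1 h2 1
  rw [Matrix.mul_one, hC, Matrix.trace_one, Matrix.submatrix_one _ (blockIdx_injective h),
    Matrix.one_mul] at this
  rw [this]
  simp

/-- Compression of a Hermitian matrix to a projection of this kind is bounded by Ky Fan. -/
theorem neg_re_trace_compression_le {n a r i : ℕ} (h0 : 0 + a ≤ n) (h : a + r ≤ n)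
    (hι : Fintype.card ι = a + i) {C : Matrix (Fin n) ι ℂ}
    (hC : Cᴴ * C = 1) (h1 : ∀ j : Fin n, (j : ℕ) < a → ∑ l, Complex.normSq (C j l) = 1)
    (h2 : ∀ j : Fin n, a + r ≤ (j : ℕ) → ∑ l, Complex.normSq (C j l) = 0)
    (β : Matrix (Fin n) (Fin n) ℂ) {H : Matrix (Fin r) (Fin r) ℂ} (hH : H.IsHermitian)
    (hHβ : H = -β.submatrix (blockIdx a r h) (blockIdx a r h))
    (hi : i ≤ Fintype.card (Fin r)) :
    -(Cᴴ * β * C).trace.re ≤ -(∑ k, β (blockIdx 0 a h0 k) (blockIdx 0 a h0 k)).re +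
      ∑ j : Fin i, hH.eigenvalues₀ (Fin.castLE hi j) := by
  obtain ⟨hp0, hp1⟩ := (isHermitian_mul_conjTranspose_self C).posSemidef_of_idempotent
    (projection_mul_self hC)
  have hp1' := hp1.submatrix (blockIdx a r h)
  rw [Matrix.submatrix_sub, Pi.sub_apply, Pi.sub_apply,
    Matrix.submatrix_one _ (blockIdx_injective h)] at hp1'
  have := hH.re_trace_mul_le_sum_eigenvalues₀ (hp0.submatrix (blockIdx a r h)) hp1' hi (by
    rw [trace_projection_block h0 h hC h1 h2, hι]; push_cast; ring)
  rw [trace_compression h0 h hC h1 h2 β, Complex.add_re]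
  have hHQ := congrArg (fun N => (N * (C * Cᴴ).submatrix (blockIdx a r h)
    (blockIdx a r h)).trace.re) hHβ
  simp only [Matrix.neg_mul, Matrix.trace_neg, Complex.neg_re] at hHQ
  linarith

/-- Columns for which the Ky Fan bound is attained. -/
theorem exists_compression_eq {n a r i : ℕ} (h0 : 0 + a ≤ n) (h : a + r ≤ n)
    (β : Matrix (Fin n) (Fin n) ℂ) {H : Matrix (Fin r) (Fin r) ℂ} (hH : H.IsHermitian)
    (hHβ : H = -β.submatrix (blockIdx a r h) (blockIdx a r h))
    (hi : i ≤ Fintype.card (Fin r)) :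
    ∃ C : Matrix (Fin n) (Fin a ⊕ Fin i) ℂ, Cᴴ * C = 1 ∧
      (∀ j : Fin n, (j : ℕ) < a → ∑ l, Complex.normSq (C j l) = 1) ∧
      (∀ j : Fin n, a + r ≤ (j : ℕ) → ∑ l, Complex.normSq (C j l) = 0) ∧
      -(Cᴴ * β * C).trace.re = -(∑ k, β (blockIdx 0 a h0 k) (blockIdx 0 a h0 k)).re +
      ∑ j : Fin i, hH.eigenvalues₀ (Fin.castLE hi j) := by
  obtain ⟨V, hV, hVt⟩ := hH.exists_orthonormal_trace_eq hi
  set e₁ := blockIdx 0 a h0 with he₁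
  set e₂ := blockIdx a r h with he₂
  have hne : ∀ x y, e₁ x ≠ e₂ y := by
    intro x y he
    have := congrArg Fin.val he
    simp only [he₁, he₂, blockIdx] at this
    omega
  have hi₁ : Function.Injective e₁ := blockIdx_injective h0
  have hi₂ : Function.Injective e₂ := blockIdx_injective h
  let E₁ : Matrix (Fin n) (Fin a) ℂ := (1 : Matrix (Fin n) (Fin n) ℂ).submatrix id e₁
  let E₂ : Matrix (Fin n) (Fin r) ℂ := (1 : Matrix (Fin n) (Fin n) ℂ).submatrix id e₂
  have hconj : ∀ {μ ν : Type} (f : μ → Fin n) (g : ν → Fin n) (N : Matrix (Fin n) (Fin n) ℂ),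
      ((1 : Matrix (Fin n) (Fin n) ℂ).submatrix id f)ᴴ * N *
        (1 : Matrix (Fin n) (Fin n) ℂ).submatrix id g = N.submatrix f g := by
    intro μ ν f g N
    ext x y
    simp [Matrix.mul_apply, Matrix.one_apply]
  have h11 : ∀ N : Matrix (Fin n) (Fin n) ℂ, E₁ᴴ * N * E₁ = N.submatrix e₁ e₁ := hconj e₁ e₁
  have h12 : E₁ᴴ * E₂ = 0 := by
    have := hconj e₁ e₂ 1
    rw [Matrix.mul_one] at this
    refine this.trans ?_
    ext x y
    simp [hne]
  have h22 : ∀ N : Matrix (Fin n) (Fin n) ℂ, E₂ᴴ * N * E₂ = N.submatrix e₂ e₂ := hconj e₂ e₂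
  have h11' : E₁ᴴ * E₁ = 1 := by
    have := h11 1
    rwa [Matrix.mul_one, Matrix.submatrix_one _ hi₁] at this
  have h22' : E₂ᴴ * E₂ = 1 := by
    have := h22 1
    rwa [Matrix.mul_one, Matrix.submatrix_one _ hi₂] at this
  have h21 : E₂ᴴ * E₁ = 0 := by
    have := congrArg Matrix.conjTranspose h12
    rwa [conjTranspose_mul, conjTranspose_conjTranspose, conjTranspose_zero] at this
  have hEV : ∀ (j : Fin n) l, (j : ℕ) < a ∨ a + r ≤ (j : ℕ) → (E₂ * V) j l = 0 := by
    intro j l hj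
    rw [Matrix.mul_apply]
    refine Finset.sum_eq_zero fun y _ => ?_
    have : j ≠ e₂ y := by
      intro he
      have := congrArg Fin.val he
      simp only [he₂, blockIdx] at this
      omega
    simp [E₂, this]
  -- The first a coordinate vectors, followed by the Ky Fan maximizer V placed in the block.
  refine ⟨fromCols E₁ (E₂ * V), ?_, ?_, ?_, ?_⟩
  · rw [conjTranspose_fromCols_eq_fromRows_conjTranspose, fromRows_mul_fromCols, h11',
      ← Matrix.mul_assoc, h12, conjTranspose_mul, Matrix.mul_assoc, h21, Matrix.mul_assoc,
      ← Matrix.mul_assoc E₂ᴴ, h22', Matrix.one_mul, hV, Matrix.zero_mul, Matrix.mul_zero,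
      fromBlocks_one]
  · intro j hj
    have hj' : ∀ x : Fin a, Complex.normSq (E₁ j x) = if x = ⟨j, hj⟩ then 1 else 0 := by
      intro x
      have : j = e₁ x ↔ x = ⟨j, hj⟩ := by
        simp only [he₁, blockIdx, Fin.ext_iff]; omega
      simp only [E₁, Matrix.submatrix_apply, id, Matrix.one_apply, this]
      split_ifs <;> simp
    simp [Fintype.sum_sum_type, hEV j _ (Or.inl hj), hj']
  · intro j hj
    have hj' : ∀ x : Fin a, E₁ j x = 0 := by
      intro x
      have : j ≠ e₁ x := by
        intro he
        have := congrArg Fin.val he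
        simp only [he₁, blockIdx] at this
        omega
      simp [E₁, this]
    simp [Fintype.sum_sum_type, hEV j _ (Or.inr hj), hj']
  · have htr : ((fromCols E₁ (E₂ * V))ᴴ * β * fromCols E₁ (E₂ * V)).trace =
        (E₁ᴴ * β * E₁).trace + (Vᴴ * (E₂ᴴ * β * E₂) * V).trace := by
      rw [conjTranspose_fromCols_eq_fromRows_conjTranspose, fromRows_mul, fromRows_mul_fromCols,
        conjTranspose_mul]
      simp only [Matrix.trace, Matrix.diag, Fintype.sum_sum_type, fromBlocks_apply₁₁,
        fromBlocks_apply₂₂, Matrix.mul_assoc]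
    have hβ : E₂ᴴ * β * E₂ = -H := by rw [h22, hHβ, neg_neg]
    rw [htr, h11, hβ, Matrix.mul_neg, Matrix.neg_mul, Matrix.trace_neg, Complex.add_re,
      Complex.neg_re, hVt, neg_add, neg_neg]
    rfl

end

/-! ### The form of B on the minimizers at A -/

section
variable {n m : ℕ}

/-- Every minimizer `X` of the trace at `A` satisfies the derivative bound. -/
theorem neg_re_trace_le_of_minimizer (hm : 1 ≤ m) (hmn : m ≤ n)
    {A M : Matrix (Fin n ⊕ Fin n) (Fin n ⊕ Fin n) ℝ} (hA : A.PosDef) (hM : M ∈ SpEig n A)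
    (B : SymMat n) {X : Matrix (Fin n ⊕ Fin n) (Fin m) ℂ} (hX : Xᴴ * hermJ n * X = (2 : ℂ) • 1)
    (hXA : (Xᴴ * toComplex A * X).trace.re ≤ 2 * ∑ j ∈ Finset.Icc 1 m, sympEig A j) :
    -(Xᴴ * toComplex B.1 * X).trace.re ≤ (Bbar A M B.1 hmn).trace +
        ∑ j : Fin (iIdx A m),
          (Btt_isHermitian A M B hmn).eigenvalues₀ (Fin.castLE (iIdx_le_card A m) j) := by
  obtain ⟨hd, hpos, -⟩ := isWilliamson_sympEigFin hA
  obtain ⟨hMJ, hMA⟩ := symplectic_of_mem_SpEig hM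
  obtain ⟨C, E, rfl, hCE⟩ := exists_coordinates hMJ hX
  rw [re_trace_of_diagonal hMA, sum_sympEig_eq hmn] at hXA
  obtain ⟨rfl, hw⟩ := eq_zero_and_weights_of_indefinite_eq hm hmn hd hpos (Fintype.card_fin m) hCE
    (le_of_mul_le_mul_left hXA two_pos)
  rw [quadratic_of_holomorphic B.2, trace_Bbar_eq]
  have hi := iIdx_le A m
  exact neg_re_trace_compression_le (bar_bound A hmn) (tilde_bound A hmn)
    (by rw [Fintype.card_fin]; omega) (by simpa using hCE)
    (fun j hj => (hw j).1 (lt_of_lt_block hm hmn hd hj))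
    (fun j hj => (hw j).2 (lt_of_block_le hm hmn hd hj)) _ _ (Btt_eq A M B.1 hmn) _

/-- Some minimizer of the trace at `A` attains the derivative bound. -/
theorem exists_minimizer_eq (hm : 1 ≤ m) (hmn : m ≤ n)
    {A M : Matrix (Fin n ⊕ Fin n) (Fin n ⊕ Fin n) ℝ} (hA : A.PosDef) (hM : M ∈ SpEig n A)
    (B : SymMat n) : ∃ X : Matrix (Fin n ⊕ Fin n) (Fin (m - iIdx A m) ⊕ Fin (iIdx A m)) ℂ,
      Xᴴ * hermJ n * X = (2 : ℂ) • 1 ∧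
      (Xᴴ * toComplex A * X).trace.re = 2 * ∑ j ∈ Finset.Icc 1 m, sympEig A j ∧
      -(Xᴴ * toComplex B.1 * X).trace.re = (Bbar A M B.1 hmn).trace +
        ∑ j : Fin (iIdx A m),
          (Btt_isHermitian A M B hmn).eigenvalues₀ (Fin.castLE (iIdx_le_card A m) j) := by
  obtain ⟨hd, hpos, -⟩ := isWilliamson_sympEigFin hA
  obtain ⟨hMJ, hMA⟩ := symplectic_of_mem_SpEig hM
  obtain ⟨C, hC, h1, h2, h3⟩ := exists_compression_eq (bar_bound A hmn) (tilde_bound A hmn)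
    (hermPart (Mᵀ * B.1 * M)) (Btt_isHermitian A M B hmn) (Btt_eq A M B.1 hmn) (iIdx_le_card A m)
  have hi := iIdx_le A m
  have hr : rIdx A m = iIdx A m + jIdx A m := rfl
  refine ⟨toComplex M * pairing n *
    fromRows C (0 : Matrix (Fin n) (Fin (m - iIdx A m) ⊕ Fin (iIdx A m)) ℂ),
    hermJ_of_coordinates hMJ (by simpa using hC), ?_, ?_⟩
  · rw [re_trace_of_diagonal hMA, sum_sympEig_eq hmn]
    simp only [Matrix.zero_apply, map_zero, Finset.sum_const_zero, add_zero]
    rw [sum_mul_eq_sum_castLE_add hmn (sympEigFin A) (fun j => ∑ l, Complex.normSq (C j l))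
      (by
        rw [sum_normSq_eq_card hC, Fintype.card_sum, Fintype.card_fin, Fintype.card_fin,
          Nat.sub_add_cancel hi])
      (sympEigFin A ⟨m - 1, by omega⟩), add_eq_left.2]
    refine Finset.sum_eq_zero fun j _ => ?_
    -- Outside the block the weight agrees with the indicator of j < m; inside it d_j equals the
    -- threshold.
    by_cases hj : (j : ℕ) < m - iIdx A m
    · rw [h1 j hj, if_pos (by omega), sub_self, mul_zero]
    · by_cases hj' : m - iIdx A m + rIdx A m ≤ (j : ℕ)
      · rw [h2 j hj', if_neg (by omega), sub_self, mul_zero]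
      · rw [(sympEigFin_eq_iff hm hmn hd j).2 ⟨by omega, by omega⟩, sub_self, zero_mul]
  · rw [quadratic_of_holomorphic B.2, trace_Bbar_eq, h3]

end

/-! ### Uniform positivity under perturbation -/

section
variable {κ ι : Type*}

theorem Matrix.PosDef.of_posSemidef_sub [DecidableEq κ] {P : Matrix κ κ ℝ} {c : ℝ} (hc : 0 < c)
    (h : (P - c • 1).PosSemidef) : P.PosDef := by
  have := PosDef.posSemidef_add h (PosDef.one.smul hc)
  rwa [sub_add_cancel] at this

variable [Fintype κ]

theorem re_trace_add_smul [Fintype ι] (P H : Matrix κ κ ℝ) (t : ℝ) (X : Matrix κ ι ℂ) :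
    (Xᴴ * toComplex (P + t • H) * X).trace.re =
      (Xᴴ * toComplex P * X).trace.re + t * (Xᴴ * toComplex H * X).trace.re := by
  rw [toComplex_add, toComplex_smul, Matrix.mul_add, Matrix.add_mul, Matrix.mul_smul,
    Matrix.smul_mul, Matrix.trace_add, Matrix.trace_smul, Complex.add_re, smul_eq_mul,
    Complex.re_ofReal_mul]

variable [DecidableEq κ]

theorem Matrix.IsHermitian.posSemidef_sub_smul_one {H : Matrix κ κ ℝ} (hH : H.IsHermitian) {c : ℝ}
    (hc : ∀ i, c ≤ hH.eigenvalues i) : (H - c • 1).PosSemidef := by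
  set V := (hH.eigenvectorUnitary : Matrix κ κ ℝ) with hV
  have hVV : V * star V = 1 := Unitary.coe_mul_star_self hH.eigenvectorUnitary
  have h1 : H = V * diagonal hH.eigenvalues * Vᴴ := hH.spectral_theorem
  have h2 : H - c • 1 = V * diagonal (fun i => hH.eigenvalues i - c) * Vᴴ := by
    have h3 : diagonal (fun i => hH.eigenvalues i - c) = diagonal hH.eigenvalues - c • 1 := by
      ext i j
      by_cases h : i = j <;> simp [h]
    rw [h3, Matrix.mul_sub, Matrix.sub_mul, ← h1, Matrix.mul_smul, Matrix.smul_mul, Matrix.mul_one]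
    congr 2
    exact hVV.symm
  rw [h2]
  exact (PosSemidef.diagonal fun i => sub_nonneg.2 (hc i)).mul_mul_conjTranspose_same V

theorem Matrix.PosDef.exists_pos_posSemidef_sub {P : Matrix κ κ ℝ} (hP : P.PosDef) :
    ∃ c : ℝ, 0 < c ∧ (P - c • 1).PosSemidef := by
  have hs : 0 ≤ ∑ i, (hP.1.eigenvalues i)⁻¹ :=
    Finset.sum_nonneg fun i _ => (inv_pos.2 (hP.eigenvalues_pos i)).le
  -- A lower bound for all eigenvalues that needs no minimum, hence no nonempty index type.
  refine ⟨(∑ i, (hP.1.eigenvalues i)⁻¹ + 1)⁻¹, by positivity,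
    hP.1.posSemidef_sub_smul_one fun i => ?_⟩
  refine inv_le_of_inv_le₀ (hP.eigenvalues_pos i) ?_
  have := Finset.single_le_sum (f := fun i => (hP.1.eigenvalues i)⁻¹)
    (fun i _ => (inv_pos.2 (hP.eigenvalues_pos i)).le) (Finset.mem_univ i)
  linarith

theorem Matrix.IsHermitian.exists_pos_posSemidef_add {H : Matrix κ κ ℝ} (hH : H.IsHermitian) :
    ∃ b : ℝ, 0 < b ∧ (H + b • 1).PosSemidef := by
  have hs : 0 ≤ ∑ i, |hH.eigenvalues i| := Finset.sum_nonneg fun i _ => abs_nonneg _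
  refine ⟨∑ i, |hH.eigenvalues i| + 1, by positivity, ?_⟩
  have := hH.posSemidef_sub_smul_one (c := -(∑ i, |hH.eigenvalues i| + 1)) fun i => ?_
  · rwa [neg_smul, sub_neg_eq_add] at this
  · have h1 := Finset.single_le_sum (f := fun i => |hH.eigenvalues i|)
      (fun i _ => abs_nonneg _) (Finset.mem_univ i)
    have h2 := neg_abs_le (hH.eigenvalues i)
    linarith

/-- Positive definiteness is stable under small perturbations, with a uniform lower bound. -/
theorem Matrix.PosDef.exists_uniform_posSemidef {P H : Matrix κ κ ℝ} (hP : P.PosDef)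
    (hH : H.IsHermitian) : ∃ c δ : ℝ, 0 < c ∧ 0 < δ ∧
      ∀ t, 0 < t → t < δ → (P + t • H - c • 1).PosSemidef := by
  obtain ⟨c, hc, hPc⟩ := hP.exists_pos_posSemidef_sub
  obtain ⟨b, hb, hHb⟩ := hH.exists_pos_posSemidef_add
  -- Half of c is kept as the bound; the other half absorbs tH ≥ -tb as long as tb < c/2.
  refine ⟨c / 2, c / 2 / b, by positivity, by positivity, fun t ht htδ => ?_⟩
  rw [lt_div_iff₀ hb] at htδ
  have : P + t • H - (c / 2) • (1 : Matrix κ κ ℝ) =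
      P - c • 1 + t • (H + b • 1) + (c / 2 - t * b) • 1 := by module
  rw [this]
  exact (hPc.add (hHb.smul ht.le)).add (PosSemidef.one.smul (by linarith))

open scoped ComplexOrder MatrixOrder in
-- Writing P = RᵀR + c makes the trace ‖RX‖² + c‖X‖². This coercivity bounds the minimizers near A.
theorem mul_sum_normSq_le [Fintype ι] [DecidableEq ι] {P : Matrix κ κ ℝ} {c : ℝ}
    (h : (P - c • 1).PosSemidef)
    (X : Matrix κ ι ℂ) :
    c * ∑ i, ∑ l, Complex.normSq (X i l) ≤ (Xᴴ * toComplex P * X).trace.re := by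
  obtain ⟨R, hR⟩ := CStarAlgebra.nonneg_iff_eq_star_mul_self.1 h.nonneg
  have hR' : P = Rᵀ * R + c • 1 := by rw [← sub_eq_iff_eq_add]; exact hR
  have h1 : (Xᴴ * X).trace.re = ∑ i, ∑ l, Complex.normSq (X i l) := by
    rw [Matrix.trace_mul_comm]
    simp only [Matrix.trace, Matrix.diag, Complex.re_sum, mul_conjTranspose_self_apply_self]
  have h2 : Xᴴ * toComplex P * X = (toComplex R * X)ᴴ * (toComplex R * X) + (c : ℂ) • (Xᴴ * X) := by
    rw [hR', toComplex_add, toComplex_mul, toComplex_smul, toComplex_one, conjTranspose_mul,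
      conjTranspose_toComplex, Matrix.mul_add, Matrix.add_mul, Matrix.mul_smul, Matrix.mul_one,
      Matrix.smul_mul]
    simp only [Matrix.mul_assoc]
  have h3 : 0 ≤ ((toComplex R * X)ᴴ * (toComplex R * X)).trace.re :=
    (Complex.nonneg_iff.1 (posSemidef_conjTranspose_mul_self (toComplex R * X)).trace_nonneg).1
  rw [h2, Matrix.trace_add, Matrix.trace_smul, Complex.add_re, smul_eq_mul, Complex.re_ofReal_mul,
    h1]
  linarith

end

/-! ### The limit of the difference quotient -/

section
open Filter Topology

variable {n m : ℕ}

/-- The difference quotient of `-2 ∑ d_j` converges, given the bound over the minimizers at `A`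
and a minimizer that attains it. -/
theorem tendsto_quotient (hmn : m ≤ n) {A B : Matrix (Fin n ⊕ Fin n) (Fin n ⊕ Fin n) ℝ}
    (hA : A.PosDef) (hB : B.IsHermitian) {L : ℝ}
    (hle : ∀ X : Matrix (Fin n ⊕ Fin n) (Fin m) ℂ, Xᴴ * hermJ n * X = (2 : ℂ) • 1 →
      (Xᴴ * toComplex A * X).trace.re ≤ 2 * ∑ j ∈ Finset.Icc 1 m, sympEig A j →
      -(Xᴴ * toComplex B * X).trace.re ≤ L)
    {ι : Type*} [Fintype ι] [DecidableEq ι] (hι : Fintype.card ι = m)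
    {X₀ : Matrix (Fin n ⊕ Fin n) ι ℂ} (hX₀ : X₀ᴴ * hermJ n * X₀ = (2 : ℂ) • 1)
    (hX₀A : (X₀ᴴ * toComplex A * X₀).trace.re = 2 * ∑ j ∈ Finset.Icc 1 m, sympEig A j)
    (hX₀B : -(X₀ᴴ * toComplex B * X₀).trace.re = L) :
    Tendsto (fun t : ℝ => (-2 * ∑ j ∈ Finset.Icc 1 m, sympEig (A + t • B) j -
      -2 * ∑ j ∈ Finset.Icc 1 m, sympEig A j) / t) (𝓝[>] 0) (𝓝 L) := by
  obtain ⟨c, δ, hc, hδ, hpsd⟩ := hA.exists_uniform_posSemidef hB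
  have hpd : ∀ t, 0 < t → t < δ → (A + t • B).PosDef := fun t ht htδ =>
    PosDef.of_posSemidef_sub hc (hpsd t ht htδ)
  have hev : ∀ᶠ t : ℝ in 𝓝[>] 0, 0 < t ∧ t < δ := Ioo_mem_nhdsGT hδ
  -- The constraint does not involve A, so X₀ is an admissible competitor at A + tB.
  have hup : ∀ t, 0 < t → t < δ → 2 * ∑ j ∈ Finset.Icc 1 m, sympEig (A + t • B) j ≤
      2 * ∑ j ∈ Finset.Icc 1 m, sympEig A j - t * L := by
    intro t ht htδ
    have := two_mul_sum_sympEig_le hmn (hpd t ht htδ) hι hX₀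
    rw [re_trace_add_smul, hX₀A] at this
    rw [← hX₀B]
    linarith
  refine tendsto_order.2 ⟨fun l hl => ?_, fun u hu => ?_⟩
  · filter_upwards [hev] with t ⟨ht, htδ⟩
    rw [lt_div_iff₀ ht]
    have := hup t ht htδ
    have := mul_lt_mul_of_pos_left hl ht
    linarith
  -- Otherwise some t_k → 0⁺ have quotient at least u > L; minimizers at A + t_k B will accumulate
  -- at a minimizer at A violating `hle`.
  · by_contra hcon
    have hfr := (Filter.not_eventually.1 hcon).and_eventually hev
    obtain ⟨t, ht0, ht⟩ := Filter.exists_seq_forall_of_frequently hfr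
    have hX : ∀ k, ∃ X : Matrix (Fin n ⊕ Fin n) (Fin m) ℂ, Xᴴ * hermJ n * X = (2 : ℂ) • 1 ∧
        (Xᴴ * toComplex (A + t k • B) * X).trace.re =
          2 * ∑ j ∈ Finset.Icc 1 m, sympEig (A + t k • B) j :=
      fun k => exists_re_trace_eq hmn (hpd _ (ht k).2.1 (ht k).2.2)
    choose X hXJ hXP using hX
    -- From c‖X_k‖² ≤ 2 ∑ d_j(A + t_k B) ≤ 2 ∑ d_j(A) - t_k L and t_k < δ.
    set F := (2 * ∑ j ∈ Finset.Icc 1 m, sympEig A j + δ * |L|) / c with hF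
    have hbound : ∀ k i l, ‖X k i l‖ ≤ √F := by
      intro k i l
      have h1 := mul_sum_normSq_le (hpsd _ (ht k).2.1 (ht k).2.2) (X k)
      rw [hXP] at h1
      have h2 := hup _ (ht k).2.1 (ht k).2.2
      have h3 : -(t k * L) ≤ δ * |L| := by
        calc -(t k * L) = t k * (-L) := by ring
          _ ≤ t k * |L| := mul_le_mul_of_nonneg_left (neg_le_abs L) (ht k).2.1.le
          _ ≤ δ * |L| := mul_le_mul_of_nonneg_right (ht k).2.2.le (abs_nonneg L)
      have h4 : Complex.normSq (X k i l) ≤ ∑ i, ∑ l, Complex.normSq (X k i l) :=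
        (Finset.single_le_sum (f := fun l => Complex.normSq (X k i l))
          (fun l _ => Complex.normSq_nonneg _) (Finset.mem_univ l)).trans
        (Finset.single_le_sum (f := fun i => ∑ l, Complex.normSq (X k i l))
          (fun i _ => Finset.sum_nonneg fun l _ => Complex.normSq_nonneg _) (Finset.mem_univ i))
      refine Real.le_sqrt_of_sq_le ?_
      rw [← Complex.normSq_eq_norm_sq, hF, le_div_iff₀ hc]
      have := mul_le_mul_of_nonneg_left h4 hc.le
      linarith
    have hcomp : IsCompact {Y : Matrix (Fin n ⊕ Fin n) (Fin m) ℂ | ∀ i l, ‖Y i l‖ ≤ √F} := by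
      have hset : {Y : Fin n ⊕ Fin n → Fin m → ℂ | ∀ i l, ‖Y i l‖ ≤ √F} =
          Set.univ.pi fun _ => Set.univ.pi fun _ => Metric.closedBall 0 √F := by
        ext Y
        simp [Set.mem_pi]
      change @IsCompact (Fin n ⊕ Fin n → Fin m → ℂ) _ {Y | ∀ i l, ‖Y i l‖ ≤ √F}
      rw [hset]
      exact isCompact_univ_pi fun _ => isCompact_univ_pi fun _ => isCompact_closedBall _ _
    have : FirstCountableTopology (Matrix (Fin n ⊕ Fin n) (Fin m) ℂ) :=
      inferInstanceAs (FirstCountableTopology (Fin n ⊕ Fin n → Fin m → ℂ))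
    obtain ⟨Y, -, φ, hφ, hY⟩ := hcomp.tendsto_subseq (x := X) fun k => hbound k
    have hq : ∀ N : Matrix (Fin n ⊕ Fin n) (Fin n ⊕ Fin n) ℂ,
        Continuous fun X : Matrix (Fin n ⊕ Fin n) (Fin m) ℂ => Xᴴ * N * X :=
      fun N => (continuous_id.matrix_conjTranspose.matrix_mul continuous_const).matrix_mul
        continuous_id
    have hqr : ∀ N : Matrix (Fin n ⊕ Fin n) (Fin n ⊕ Fin n) ℂ, Tendsto
        (fun k => ((X (φ k))ᴴ * N * X (φ k)).trace.re) atTop (𝓝 (Yᴴ * N * Y).trace.re) := fun N =>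
      ((Complex.continuous_re.comp (hq N).matrix_trace).tendsto Y).comp hY
    have htφ : Tendsto (fun k => t (φ k)) atTop (𝓝 0) :=
      (tendsto_nhds_of_tendsto_nhdsWithin ht0).comp hφ.tendsto_atTop
    have hYJ : Yᴴ * hermJ n * Y = (2 : ℂ) • 1 := by
      refine tendsto_nhds_unique (((hq (hermJ n)).tendsto Y).comp hY) ?_
      simp only [Function.comp_def, hXJ]
      exact tendsto_const_nhds
    have hYA : (Yᴴ * toComplex A * Y).trace.re ≤ 2 * ∑ j ∈ Finset.Icc 1 m, sympEig A j := by
      have h1 := (hqr (toComplex A)).add (htφ.mul (hqr (toComplex B)))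
      have h2 : Tendsto (fun k => 2 * ∑ j ∈ Finset.Icc 1 m, sympEig A j - t (φ k) * L) atTop
          (𝓝 (2 * ∑ j ∈ Finset.Icc 1 m, sympEig A j - 0 * L)) :=
        tendsto_const_nhds.sub (htφ.mul_const L)
      have h3 := le_of_tendsto_of_tendsto' h1 h2 fun k => by
        rw [← re_trace_add_smul, hXP]
        exact hup _ (ht _).2.1 (ht _).2.2
      simpa using h3
    have hYB : u ≤ -(Yᴴ * toComplex B * Y).trace.re := by
      refine ge_of_tendsto' (hqr (toComplex B)).neg fun k => ?_
      have h1 := not_lt.1 (ht (φ k)).1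
      have htk := (ht (φ k)).2.1
      rw [le_div_iff₀ htk] at h1
      have h2 := hXP (φ k)
      rw [re_trace_add_smul] at h2
      -- Conversely X_k competes at A, so the quotient at t_k is at most -Re tr(X_kᴴ B X_k).
      have h3 := two_mul_sum_sympEig_le hmn hA (Fintype.card_fin m) (hXJ (φ k))
      refine le_of_mul_le_mul_left ?_ htk
      linarith
    exact absurd (hYB.trans (hle Y hYJ hYA)) (not_le.2 hu)

end

theorem mainTheorem4 (n m : ℕ) (hm : 1 ≤ m) (hmn : m ≤ n)
    (A : SymMat n) (hA : (A : Matrix (Fin n ⊕ Fin n) (Fin n ⊕ Fin n) ℝ).PosDef)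
    (M : Matrix (Fin n ⊕ Fin n) (Fin n ⊕ Fin n) ℝ) (hM : M ∈ SpEig n A.1)
    (B : SymMat n) :
    HasDirDeriv (sigma n m) A B
      ((Bbar A.1 M B.1 hmn).trace +
        ∑ j : Fin (iIdx A.1 m),
          (Btt_isHermitian A.1 M B hmn).eigenvalues₀ (Fin.castLE (iIdx_le_card A.1 m) j)) := by
  have hB : B.1.IsHermitian := by
    rw [Matrix.IsHermitian, conjTranspose_eq_transpose_of_trivial]; exact B.2
  obtain ⟨X₀, hX₀, hX₀A, hX₀B⟩ := exists_minimizer_eq hm hmn hA hM B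
  have hlim := tendsto_quotient hmn hA hB
    (fun X => neg_re_trace_le_of_minimizer hm hmn hA hM B)
    (by
      rw [Fintype.card_sum, Fintype.card_fin, Fintype.card_fin, Nat.sub_add_cancel (iIdx_le A.1 m)])
    hX₀ hX₀A hX₀B
  refine ((continuous_coe_real_ereal.tendsto _).comp hlim).congr' ?_
  -- For small t > 0 the point A + tB is positive definite, so `sigma` takes its finite values and
  -- the extended-real quotient is the real one.
  obtain ⟨c, δ, hc, hδ, hpsd⟩ := hA.exists_uniform_posSemidef hB
  filter_upwards [Ioo_mem_nhdsGT hδ] with t ht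
  have hpd : ((A + t • B : SymMat n) : Matrix (Fin n ⊕ Fin n) (Fin n ⊕ Fin n) ℝ).PosDef :=
    PosDef.of_posSemidef_sub hc (hpsd t ht.1 ht.2)
  rw [sigma, sigma, if_pos hpd, if_pos hA, ← EReal.coe_sub, ← EReal.coe_div]
  rfl
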